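/- All groups are countable and discrete. **Measure equivalence.** Let $\Gamma,\Delta$ be such groups. A *coupling* of $\Gamma$ and $\Delta$ is a nonzero $\sigma$-finite standard measure space $(\Sigma,\sigma)$ with commuting, measure-preserving, (essentially) free actions of $\Gamma$ (on the left) and $\Delta$ (on the right), each admitting a measurable fundamental domain (up to null sets, possibly of infinite measure), so that, up to null sets, $\Sigma/\Delta$ and $\Gamma\backslash\Sigma$ are standard measure spaces: they are identified with fundamental domains carrying the restriction of $\sigma$. $\Gamma$ and $\Delta$ are *measure equivalent* (in Gromov's sense) if they have a coupling in which both fundamental domains have finite measure. They are *amenably measure equivalent* if they have a coupling with $\sigma(\Sigma)=\infty$ such that $(\Gamma,\Sigma/\Delta)$ and $(\Delta,\Gamma\backslash\Sigma)$ are amenable pairs. Here, for a group $G$ acting on $(X,\mu)$ preserving the measure class, $(G,X)$ is an *amenable pair* if $L^\infty(X,\mu)$ has a $G$-invariant state. **Weak amenability properties.** $\Gamma$ has the *Haagerup property* if there is a sequence of positive definite functions $u_n$ on $\Gamma$ with $u_n(1)=1$, $u_n\in C_0(\Gamma)$, and $u_n\to 1$ uniformly on finite sets. $A(\Gamma)$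 is the set of functions $g\mapsto\langle\lambda(g)\xi\,|\,\eta\rangle$ with $\xi,\eta\in\ell^2(\Gamma)$, $\lambda$ being the left regular representation. $B_2(\Gamma)$ is the set of functions $u:\Gamma\to\mathbb C$ for which there are a separable Hilbert space $\mathcal H$ and bounded maps $\xi,\eta:\Gamma\to\mathcal H$ with $u(h^{-1}g)=\langle\xi(g)\,|\,\eta(h)\rangle$ for all $g,h\in\Gamma$; $\|u\|_{B_2}$ is the infimum of $\|\xi\|_\infty\|\eta\|_\infty$ over all such representations. $\Lambda_{\mathrm{WA}}(\Gamma)$ (resp. $\Lambda_{\mathrm{WH}}(\Gamma)$) is the infimum in $[1,\infty]$ of all $C\ge 1$ for which there is a sequence $(u_n)$ in $A(\Gamma)$ (resp. in $B_2(\Gamma)\cap C_0(\Gamma)$) with $\|u_n\|_{B_2}\le C$ for all $n$ and $u_n\to 1$ uniformly on finite sets; it is $\infty$ if there is no such $C$. **Theorem.** Let $\Gamma$ and $\Delta$ be countable discrete groups. If $\Gamma$ and $\Delta$ are amenably measure equivalent, then 1. $\Gamma$ has the Haagerup property if and only if $\Delta$ does; 2. $\Lambda_{\mathrm{WA}}(\Gamma)=\Lambda_{\mathrm{WA}}(\Delta)$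 and $\Lambda_{\mathrm{WH}}(\Gamma)=\Lambda_{\mathrm{WH}}(\Delta)$ (as elements of $[1,\infty]$). This applies in particular to measure equivalent groups: if $\Gamma$ and $\Delta$ are measure equivalent, then they are amenably measure equivalent. -/

import Mathlib

open MeasureTheory Filter Topology
open scoped ENNReal ComplexOrder

/-! ### Function spaces on a discrete group

The groups are countable and discrete: compact subsets are the finite ones, every function is
continuous, and `C₀(Γ)` is the space of functions tending to `0` along the cofinite filter. -/

/-- `u` tends to `0` at infinity on the discrete group `Γ`, i.e. `u ∈ C₀(Γ)`. -/
def VanishesAtInfinity {Γ : Type*} (u : Γ → ℂ) : Prop :=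
  Tendsto u cofinite (𝓝 0)

/-- `u n → 1` uniformly on compact (that is, finite) subsets of the discrete group `Γ`. -/
def TendsToOneOnCompacts {Γ : Type*} (u : ℕ → Γ → ℂ) : Prop :=
  ∀ K : Set Γ, K.Finite → TendstoUniformlyOn u (fun _ => 1) atTop K

/-- `u` is positive definite: `∑ c̄_g c_h u(g⁻¹h) ≥ 0` for all finitely supported families `c` of
complex numbers (in `ℂ`, `0 ≤ z` means that `z` is real and nonnegative). -/
def IsPositiveDefiniteFun {Γ : Type*} [Group Γ] (u : Γ → ℂ) : Prop :=
  ∀ (s : Finset Γ) (c : Γ → ℂ),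
    0 ≤ ∑ g ∈ s, ∑ h ∈ s, (starRingEnd ℂ) (c g) * c h * u (g⁻¹ * h)

/-- The left regular representation on `ℓ²(Γ)`: `(λ(g)ξ)(h) = ξ(g⁻¹h)`. -/
noncomputable def leftRegular {Γ : Type*} [Group Γ] (g : Γ) (ξ : lp (fun _ : Γ => ℂ) 2) :
    lp (fun _ : Γ => ℂ) 2 :=
  ⟨fun h => ξ (g⁻¹ * h), by
    have hp : 0 < (2 : ℝ≥0∞).toReal := by norm_num
    have h := (memℓp_gen_iff hp).1 (lp.memℓp ξ)
    exact (memℓp_gen_iff hp).2 (h.comp_injective (mul_right_injective g⁻¹))⟩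

/-- `u` belongs to the Fourier algebra `A(Γ)`: it is a coefficient `g ↦ ⟨λ(g)ξ | η⟩` of the left
regular representation (`inner` is conjugate-linear in its first argument). -/
def MemFourierAlgebra {Γ : Type*} [Group Γ] (u : Γ → ℂ) : Prop :=
  ∃ ξ η : lp (fun _ : Γ => ℂ) 2, ∀ g, u g = inner ℂ η (leftRegular g ξ)

/-- The set of numbers `‖ξ‖_∞ ‖η‖_∞`, where `ξ, η` are bounded functions from `Γ` to a separable
Hilbert space with `u(h⁻¹g) = ⟨ξ(g) | η(h)⟩` for all `g, h`. -/
def herzSchurValues {Γ : Type*} [Group Γ] (u : Γ → ℂ) : Set ℝ :=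
  {r | ∃ (H : Type) (_ : NormedAddCommGroup H) (_ : InnerProductSpace ℂ H) (_ : CompleteSpace H)
      (_ : TopologicalSpace.SeparableSpace H) (ξ η : Γ → H),
      BddAbove (Set.range fun g => ‖ξ g‖) ∧ BddAbove (Set.range fun g => ‖η g‖) ∧
      (∀ g h, u (h⁻¹ * g) = inner ℂ (η h) (ξ g)) ∧
      r = (⨆ g, ‖ξ g‖) * (⨆ g, ‖η g‖)}

/-- `u` belongs to the algebra `B₂(Γ)` of Herz-Schur multipliers. -/
def IsHerzSchur {Γ : Type*} [Group Γ] (u : Γ → ℂ) : Prop :=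
  (herzSchurValues u).Nonempty

/-- The norm `‖u‖_{B₂}` (meaningful for `u ∈ B₂(Γ)`). -/
noncomputable def herzSchurNorm {Γ : Type*} [Group Γ] (u : Γ → ℂ) : ℝ :=
  sInf (herzSchurValues u)

/-! ### The three weak forms of amenability -/

/-- The Haagerup property of the discrete group `Γ`. -/
def HasHaagerupProperty (Γ : Type*) [Group Γ] : Prop :=
  ∃ u : ℕ → Γ → ℂ,
    (∀ n, u n 1 = 1 ∧ IsPositiveDefiniteFun (u n) ∧ VanishesAtInfinity (u n)) ∧
    TendsToOneOnCompacts u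

/-- The Cowling-Haagerup constant `Λ_WA(Γ) ∈ [1, ∞]`; it is `∞` when no `C` is admissible. -/
noncomputable def cowlingHaagerupConst (Γ : Type*) [Group Γ] : ℝ≥0∞ :=
  ⨅ (C : ℝ) (_ : 1 ≤ C ∧ ∃ u : ℕ → Γ → ℂ,
    (∀ n, MemFourierAlgebra (u n) ∧ IsHerzSchur (u n) ∧ herzSchurNorm (u n) ≤ C) ∧
    TendsToOneOnCompacts u), ENNReal.ofReal C

/-- The weak Haagerup constant `Λ_WH(Γ) ∈ [1, ∞]`; it is `∞` when no `C` is admissible. -/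
noncomputable def weakHaagerupConst (Γ : Type*) [Group Γ] : ℝ≥0∞ :=
  ⨅ (C : ℝ) (_ : 1 ≤ C ∧ ∃ u : ℕ → Γ → ℂ,
    (∀ n, IsHerzSchur (u n) ∧ VanishesAtInfinity (u n) ∧ herzSchurNorm (u n) ≤ C) ∧
    TendsToOneOnCompacts u), ENNReal.ofReal C

/-! ### Amenable pairs and measure equivalence -/

/-- `(G, X)` is an amenable pair: `G` acts on `(X, μ)` preserving the measure class, and
`L^∞(X, μ)` has a `G`-invariant state, i.e. a positive linear functional `φ` with `φ(1) = 1`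
and `φ(f ∘ g) = φ(f)` for all `f` and all `g ∈ G`. -/
def IsAmenablePair (G X : Type*) [Group G] [MulAction G X] [MeasurableSpace X]
    (μ : Measure X) : Prop :=
  (∀ g : G, Measure.QuasiMeasurePreserving (fun x : X => g • x) μ μ) ∧
  ∃ φ : Lp ℂ ∞ μ →ₗ[ℂ] ℂ,
    (∀ f : Lp ℂ ∞ μ, (∀ᵐ x ∂μ, 0 ≤ f x) → 0 ≤ φ f) ∧
    (∀ f : Lp ℂ ∞ μ, (∀ᵐ x ∂μ, f x = 1) → φ f = 1) ∧
    (∀ (g : G) (f f' : Lp ℂ ∞ μ), (∀ᵐ x ∂μ, f' x = f (g • x)) → φ f' = φ f)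

/-- If the actions of `Γ` and `Δ` on `S` commute, then `Γ` acts on the space of `Δ`-orbits. -/
instance orbitSpaceMulAction (Γ Δ S : Type*) [Group Γ] [Group Δ] [MulAction Γ S] [MulAction Δ S]
    [SMulCommClass Γ Δ S] : MulAction Γ (MulAction.orbitRel.Quotient Δ S) where
  smul γ := Quotient.map (fun x => γ • x) (by
    rintro a b ⟨δ, rfl⟩
    exact ⟨δ, (smul_comm γ δ b).symm⟩)
  one_smul q := by
    induction q using Quotient.inductionOn with
    | h x => exact congrArg (Quotient.mk _) (one_smul Γ x)
  mul_smul γ γ' q := by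
    induction q using Quotient.inductionOn with
    | h x => exact congrArg (Quotient.mk _) (mul_smul γ γ' x)

/-- The measure on the orbit space of `Δ` obtained by identifying the orbit space with a
fundamental domain `X` equipped with the restriction of `σ`. -/
noncomputable def orbitSpaceMeasure (Δ : Type*) {S : Type*} [Group Δ] [MulAction Δ S]
    [MeasurableSpace S] (σ : Measure S) (X : Set S) :
    Measure (MulAction.orbitRel.Quotient Δ S) :=
  (σ.restrict X).map (Quotient.mk (MulAction.orbitRel Δ S))

/-- `(S, σ)` is a σ-finite standard measure space with commuting, (essentially) free,
measure-preserving actions of `Γ` and `Δ`, and `X`, `Y` are fundamental domains (possibly of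
infinite measure, defined up to null sets) of the actions of `Δ` and `Γ`, so that the orbit spaces
are standard. Both actions are written on the left; a right action of `Δ` corresponds to
the left action `δ • x = x δ⁻¹`. -/
structure IsMeasureCoupling (Γ Δ : Type*) {S : Type*} [Group Γ] [Group Δ] [MeasurableSpace S]
    [MulAction Γ S] [MulAction Δ S] [SMulCommClass Γ Δ S] (σ : Measure S) (X Y : Set S) : Prop where
  standard : StandardBorelSpace S
  sigmaFinite : SigmaFinite σ
  measurePreserving_left : ∀ γ : Γ, MeasurePreserving (fun x : S => γ • x) σ σ
  measurePreserving_right : ∀ δ : Δ, MeasurePreserving (fun x : S => δ • x) σ σ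
  free_left : ∀ γ : Γ, γ ≠ 1 → ∀ᵐ x ∂σ, γ • x ≠ x
  free_right : ∀ δ : Δ, δ ≠ 1 → ∀ᵐ x ∂σ, δ • x ≠ x
  fundamentalDomain_right : IsFundamentalDomain Δ X σ
  fundamentalDomain_left : IsFundamentalDomain Γ Y σ

universe u v w

/-- `Γ` and `Δ` are measure equivalent in the sense of Gromov: they have a coupling in
which both fundamental domains have finite measure. The coupling is only required to be nonzero,
which includes every infinite-measure coupling and also allows finite groups. -/
def IsMeasureEquivalent (Γ : Type u) (Δ : Type v) [Group Γ] [Group Δ] : Prop :=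
  ∃ (S : Type w) (_ : MeasurableSpace S) (_ : MulAction Γ S) (_ : MulAction Δ S)
    (_ : SMulCommClass Γ Δ S) (σ : Measure S) (X Y : Set S),
    IsMeasureCoupling Γ Δ σ X Y ∧ σ ≠ 0 ∧ σ X < ∞ ∧ σ Y < ∞

/-- `Γ` and `Δ` are amenably measure equivalent: they have an infinite-measure coupling
`(S, σ)` for which `(Γ, S/Δ)` and `(Δ, Γ\S)` are amenable pairs. -/
def IsAmenablyMeasureEquivalent (Γ : Type u) (Δ : Type v) [Group Γ] [Group Δ] : Prop :=
  ∃ (S : Type w) (_ : MeasurableSpace S) (_ : MulAction Γ S) (_ : MulAction Δ S)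
    (_ : SMulCommClass Γ Δ S) (_ : SMulCommClass Δ Γ S) (σ : Measure S) (X Y : Set S),
    IsMeasureCoupling Γ Δ σ X Y ∧ σ Set.univ = ∞ ∧
    IsAmenablePair Γ (MulAction.orbitRel.Quotient Δ S) (orbitSpaceMeasure Δ σ X) ∧
    IsAmenablePair Δ (MulAction.orbitRel.Quotient Γ S) (orbitSpaceMeasure Γ σ Y)

/-! ### Herz-Schur multipliers -/

/-! Functions on `Δ` are induced to functions on `Γ` through the coupling. A fundamental domain of
`Δ` gives a `Δ`-equivariant map `θ : S → Δ`, with domain `X = {θ = 1}` up to null sets. For a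
`Δ`-invariant `F ≥ 0` with `∫_X F² ≤ 1`, the function `u` on `Δ` induces `û(γ) = ∫_X F(γ⁻¹x) F(x)
u(θ(x)⁻¹ θ(γ⁻¹x)) dσ(x)` (`transfer`). The integrand is `Δ`-invariant, so `X` may be replaced by its
`Γ`-translates, which turns `û(h⁻¹g)` into an integral of the kernel `u(b⁻¹a)` at `a = θ(g⁻¹x)`, `b
= θ(h⁻¹x)`, with weights. Hence positive definiteness holds pointwise under the integral, and a
factorization of `u` through `H` induces one of `û` through `L²(X, H)` with no larger norm.

Decay at infinity uses the other fundamental domain, that is, a `Γ`-equivariant map `κ : S → Γ`. If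
`u` has finite support and `F` is cut down to the orbits on which finitely many values of `κ` stay
in a finite set, then `û` has finite support (`finite_support_transfer_restrict`). The cut costs
arbitrarily little in `L²`, so `C₀` is preserved. For `A(Γ)` one first approximates by finitely
supported functions in the Herz-Schur norm.

Amenability of `(Γ, S/Δ)` makes `û` close to `1`: a Hahn-Banach argument turns an invariant state
into almost invariant densities `f` in `L¹(S/Δ)`, and `F = √f` satisfies `∫_X F(γ⁻¹x) F(x) ≈ 1`
(`hasAlmostInvariantWeights`). So the properties pass from `Δ` to `Γ`, and by the symmetric
hypothesis also back.

A finite coupling becomes an infinite one after multiplication by `ℕ` with counting measure;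
averaging over the slice at `0` is then an invariant state. -/

theorem Orthonormal.countable_of_separable {E : Type*} [NormedAddCommGroup E]
    [InnerProductSpace ℂ E] [TopologicalSpace.SeparableSpace E] {s : Set E}
    (hs : Orthonormal ℂ ((↑) : s → E)) : s.Countable := by
  -- Distinct orthonormal vectors are at distance `√2 > 1`, so the balls of radius `1/2` are
  -- disjoint.
  have hd : s.PairwiseDisjoint (fun x => Metric.ball x (1 / 2)) := by
    intro x hx y hy hxy
    refine Metric.ball_disjoint_ball ?_
    have h0 : inner ℂ x y = 0 := hs.2 (i := ⟨x, hx⟩) (j := ⟨y, hy⟩) (by simpa using hxy)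
    have hx1 : ‖x‖ = 1 := hs.1 ⟨x, hx⟩
    have hy1 : ‖y‖ = 1 := hs.1 ⟨y, hy⟩
    have h := norm_sub_sq (𝕜 := ℂ) x y
    rw [h0, hx1, hy1] at h
    rw [dist_eq_norm]
    norm_num at h ⊢
    nlinarith [norm_nonneg (x - y)]
  exact hd.countable_of_isOpen (fun _ _ => Metric.isOpen_ball)
    (fun x _ => ⟨x, Metric.mem_ball_self (by norm_num)⟩)

/-- A separable Hilbert space in any universe is isometric to one in `Type`. -/
theorem exists_linearIsometryEquiv_type (E : Type*) [NormedAddCommGroup E]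
    [InnerProductSpace ℂ E] [CompleteSpace E] [TopologicalSpace.SeparableSpace E] :
    ∃ (H : Type) (_ : NormedAddCommGroup H) (_ : InnerProductSpace ℂ H) (_ : CompleteSpace H)
      (_ : TopologicalSpace.SeparableSpace H), Nonempty (E ≃ₗᵢ[ℂ] H) := by
  obtain ⟨s, b, hb⟩ := exists_hilbertBasis ℂ E
  have hs : s.Countable := by
    have := b.orthonormal
    rw [hb] at this
    exact this.countable_of_separable
  have : Countable s := hs
  obtain ⟨f, hf⟩ := exists_injective_nat s
  let e := Equiv.ofInjective f hf
  let b' : HilbertBasis (Set.range f) ℂ E := HilbertBasis.mk (v := b ∘ e.symm)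
    (b.orthonormal.comp _ e.symm.injective) (by
      rw [EquivLike.range_comp]
      exact b.dense_span.ge)
  refine ⟨lp (fun _ : Set.range f => ℂ) 2, inferInstance, inferInstance, inferInstance, ?_,
    ⟨b'.repr⟩⟩
  exact b'.repr.surjective.denseRange.separableSpace b'.repr.continuous

/-- A factorization of the kernel `u(h⁻¹g)` through an arbitrary Hilbert space bounds the
Herz-Schur norm. -/
theorem herzSchurNorm_le_of_factorization {Γ : Type*} [Group Γ] [Countable Γ] {u : Γ → ℂ}
    {E : Type*} [NormedAddCommGroup E] [InnerProductSpace ℂ E] [CompleteSpace E]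
    (ξ η : Γ → E) {a b : ℝ} (hξ : ∀ g, ‖ξ g‖ ≤ a) (hη : ∀ g, ‖η g‖ ≤ b)
    (hu : ∀ g h, u (h⁻¹ * g) = inner ℂ (η h) (ξ g)) :
    IsHerzSchur u ∧ herzSchurNorm u ≤ a * b := by
  -- `Γ` is countable, so the closed span of the two ranges is separable and can be moved into
  -- `Type`, as the definition of the norm demands.
  let t : Set E := Set.range ξ ∪ Set.range η
  let K : Submodule ℂ E := (Submodule.span ℂ t).topologicalClosure
  have htK : ∀ x ∈ t, x ∈ K := fun x hx =>
    Submodule.le_topologicalClosure _ (Submodule.subset_span hx)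
  have hsep : TopologicalSpace.SeparableSpace K := by
    have h1 : TopologicalSpace.IsSeparable t :=
      ((Set.countable_range ξ).union (Set.countable_range η)).isSeparable
    have h2 : TopologicalSpace.IsSeparable (K : Set E) := (h1.span (R := ℂ)).closure
    exact h2.separableSpace
  have hcomp : CompleteSpace K := (Submodule.isClosed_topologicalClosure _).completeSpace_coe
  obtain ⟨H, i1, i2, i3, i4, ⟨e⟩⟩ := exists_linearIsometryEquiv_type K
  let ξ' : Γ → H := fun g => e ⟨ξ g, htK _ (Or.inl ⟨g, rfl⟩)⟩
  let η' : Γ → H := fun g => e ⟨η g, htK _ (Or.inr ⟨g, rfl⟩)⟩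
  have hξ' : ∀ g, ‖ξ' g‖ ≤ a := fun g => (e.norm_map _).trans_le (hξ g)
  have hη' : ∀ g, ‖η' g‖ ≤ b := fun g => (e.norm_map _).trans_le (hη g)
  have hmem : (⨆ g, ‖ξ' g‖) * (⨆ g, ‖η' g‖) ∈ herzSchurValues u := by
    refine ⟨H, i1, i2, i3, i4, ξ', η', ⟨a, ?_⟩, ⟨b, ?_⟩, ?_, rfl⟩
    · rintro _ ⟨g, rfl⟩; exact hξ' g
    · rintro _ ⟨g, rfl⟩; exact hη' g
    · intro g h
      rw [hu]
      simp only [ξ', η', e.inner_map_map]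
      rfl
  refine ⟨⟨_, hmem⟩, (csInf_le ⟨0, ?_⟩ hmem).trans ?_⟩
  · rintro _ ⟨H, _, _, _, _, ξ, η, -, -, -, rfl⟩
    exact mul_nonneg (Real.iSup_nonneg fun _ => norm_nonneg _)
      (Real.iSup_nonneg fun _ => norm_nonneg _)
  · exact mul_le_mul (ciSup_le hξ') (ciSup_le hη') (Real.iSup_nonneg fun _ => norm_nonneg _)
      ((norm_nonneg _).trans (hξ 1))

/-- The norm is an infimum, hence the strict bound. Rescaling `ξ` by `√(B/A)` and `η` by its inverse
leaves the kernel unchanged and bounds both vectors by `√(AB)`. -/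
theorem IsHerzSchur.exists_factorization {Γ : Type*} [Group Γ] {u : Γ → ℂ}
    (hu : IsHerzSchur u) {C : ℝ} (hC : herzSchurNorm u < C) :
    ∃ (H : Type) (_ : NormedAddCommGroup H) (_ : InnerProductSpace ℂ H) (_ : CompleteSpace H)
      (_ : TopologicalSpace.SeparableSpace H) (ξ η : Γ → H),
      (∀ g, ‖ξ g‖ ≤ √C) ∧ (∀ g, ‖η g‖ ≤ √C) ∧ ∀ g h, u (h⁻¹ * g) = inner ℂ (η h) (ξ g) := by
  obtain ⟨_, ⟨H, i1, i2, i3, i4, ξ, η, bξ, bη, h, rfl⟩, hlt⟩ := exists_lt_of_csInf_lt hu hC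
  set A := ⨆ g, ‖ξ g‖
  set B := ⨆ g, ‖η g‖
  have hξ : ∀ g, ‖ξ g‖ ≤ A := le_ciSup bξ
  have hη : ∀ g, ‖η g‖ ≤ B := le_ciSup bη
  have hA : 0 ≤ A := (norm_nonneg _).trans (hξ 1)
  have hB : 0 ≤ B := (norm_nonneg _).trans (hη 1)
  refine ⟨H, i1, i2, i3, i4, ?_⟩
  by_cases hAB : A = 0 ∨ B = 0
  · refine ⟨fun _ => 0, fun _ => 0, by simp, by simp, fun g k => ?_⟩
    rw [h, inner_zero_left]
    rcases hAB with h0 | h0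
    · have : ξ g = 0 := norm_le_zero_iff.1 (h0 ▸ hξ g)
      rw [this, inner_zero_right]
    · have : η k = 0 := norm_le_zero_iff.1 (h0 ▸ hη k)
      rw [this, inner_zero_left]
  · push Not at hAB
    have hA' : 0 < A := lt_of_le_of_ne hA hAB.1.symm
    have hB' : 0 < B := lt_of_le_of_ne hB hAB.2.symm
    have sA := Real.sqrt_pos.2 hA'
    have sB := Real.sqrt_pos.2 hB'
    have hAA := Real.mul_self_sqrt hA
    have hBB := Real.mul_self_sqrt hB
    have hle : √A * √B ≤ √C := by
      rw [← Real.sqrt_mul hA]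
      exact Real.sqrt_le_sqrt hlt.le
    refine ⟨fun g => ((√B / √A : ℝ) : ℂ) • ξ g, fun g => ((√A / √B : ℝ) : ℂ) • η g,
      fun g => ?_, fun g => ?_, fun g k => ?_⟩
    · rw [norm_smul, Complex.norm_real, Real.norm_of_nonneg (by positivity)]
      refine le_trans (mul_le_mul_of_nonneg_left (hξ g) (by positivity)) (le_trans (le_of_eq ?_) hle)
      field_simp
      nlinarith
    · rw [norm_smul, Complex.norm_real, Real.norm_of_nonneg (by positivity)]
      refine le_trans (mul_le_mul_of_nonneg_left (hη g) (by positivity)) (le_trans (le_of_eq ?_) hle)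
      field_simp
      nlinarith
    · rw [h, inner_smul_left, inner_smul_right, Complex.conj_ofReal, ← mul_assoc,
        ← Complex.ofReal_mul]
      have : √A / √B * (√B / √A) = 1 := by field_simp
      rw [this]; simp

/-- The kernel at `h = 1` is an inner product of vectors of norm at most `√C`. Thus multipliers are
bounded functions, which makes the induction integrals converge. -/
theorem IsHerzSchur.norm_apply_le {Γ : Type*} [Group Γ] {u : Γ → ℂ}
    (hu : IsHerzSchur u) {C : ℝ} (hC : herzSchurNorm u < C) (g : Γ) : ‖u g‖ ≤ C := by
  obtain ⟨H, _, _, _, _, ξ, η, hξ, hη, h⟩ := hu.exists_factorization hC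
  have hC0 : 0 ≤ herzSchurNorm u := by
    refine Real.sInf_nonneg ?_
    rintro _ ⟨H, _, _, _, _, ξ, η, -, -, -, rfl⟩
    exact mul_nonneg (Real.iSup_nonneg fun _ => norm_nonneg _)
      (Real.iSup_nonneg fun _ => norm_nonneg _)
  have := h g 1
  rw [inv_one, one_mul] at this
  rw [this]
  refine (norm_inner_le_norm _ _).trans ((mul_le_mul (hη 1) (hξ g) (norm_nonneg _)
    (Real.sqrt_nonneg _)).trans (Real.mul_self_sqrt (hC0.trans hC.le)).le)

/-- Balanced factorizations are combined in the Hilbert sum: the squared norms add up to at most `a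
+ b`. -/
theorem IsHerzSchur.add {Γ : Type*} [Group Γ] [Countable Γ] {u v : Γ → ℂ}
    (hu : IsHerzSchur u) (hv : IsHerzSchur v) {a b : ℝ} (ha : herzSchurNorm u < a)
    (hb : herzSchurNorm v < b) (ha0 : 0 ≤ a) (hb0 : 0 ≤ b) :
    IsHerzSchur (u + v) ∧ herzSchurNorm (u + v) ≤ a + b := by
  obtain ⟨H, _, _, _, _, ξ, η, hξ, hη, h⟩ := hu.exists_factorization ha
  obtain ⟨H', _, _, _, _, ξ', η', hξ', hη', h'⟩ := hv.exists_factorization hb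
  have key : ∀ (x : H) (y : H'), ‖x‖ ≤ √a → ‖y‖ ≤ √b → ‖WithLp.toLp 2 (x, y)‖ ≤ √(a + b) := by
    intro x y hx hy
    rw [WithLp.prod_norm_eq_of_L2]
    refine Real.sqrt_le_sqrt (add_le_add ?_ ?_)
    · calc ‖x‖ ^ 2 ≤ √a ^ 2 := by gcongr
        _ = a := Real.sq_sqrt ha0
    · calc ‖y‖ ^ 2 ≤ √b ^ 2 := by gcongr
        _ = b := Real.sq_sqrt hb0
  have := herzSchurNorm_le_of_factorization (u := u + v) (E := WithLp 2 (H × H'))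
    (fun g => WithLp.toLp 2 (ξ g, ξ' g)) (fun g => WithLp.toLp 2 (η g, η' g))
    (fun g => key _ _ (hξ g) (hξ' g)) (fun g => key _ _ (hη g) (hη' g))
    (fun g k => by simp [h, h', WithLp.prod_inner_apply])
  rwa [Real.mul_self_sqrt (add_nonneg ha0 hb0)] at this

/-! ### The Fourier algebra -/

theorem inner_leftRegular {Γ : Type*} [Group Γ] (g h : Γ) (ξ η : lp (fun _ : Γ => ℂ) 2) :
    inner ℂ (leftRegular h η) (leftRegular g ξ) = inner ℂ η (leftRegular (h⁻¹ * g) ξ) := by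
  rw [lp.inner_eq_tsum, lp.inner_eq_tsum, ← (Equiv.mulLeft h).tsum_eq]
  refine tsum_congr fun k => ?_
  simp [leftRegular, mul_assoc]

theorem leftRegular_one {Γ : Type*} [Group Γ] (ξ : lp (fun _ : Γ => ℂ) 2) :
    leftRegular 1 ξ = ξ := by
  ext k; simp [leftRegular]

theorem norm_leftRegular {Γ : Type*} [Group Γ] (g : Γ) (ξ : lp (fun _ : Γ => ℂ) 2) :
    ‖leftRegular g ξ‖ = ‖ξ‖ := by
  have h := inner_leftRegular g g ξ ξ
  rw [inv_mul_cancel, leftRegular_one, inner_self_eq_norm_sq_to_K, inner_self_eq_norm_sq_to_K] at h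
  have h2 : ‖leftRegular g ξ‖ ^ 2 = ‖ξ‖ ^ 2 := by exact_mod_cast h
  exact (pow_left_inj₀ (norm_nonneg _) (norm_nonneg _) two_ne_zero).1 h2

theorem leftRegular_sub {Γ : Type*} [Group Γ] (g : Γ) (ξ η : lp (fun _ : Γ => ℂ) 2) :
    leftRegular g (ξ - η) = leftRegular g ξ - leftRegular g η := by
  ext k; rfl

theorem isHerzSchur_coefficient {Γ : Type*} [Group Γ] [Countable Γ]
    (ξ η : lp (fun _ : Γ => ℂ) 2) :
    IsHerzSchur (fun g => inner ℂ η (leftRegular g ξ)) ∧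
      herzSchurNorm (fun g => inner ℂ η (leftRegular g ξ)) ≤ ‖ξ‖ * ‖η‖ :=
  herzSchurNorm_le_of_factorization (fun g => leftRegular g ξ) (fun g => leftRegular g η)
    (fun g => (norm_leftRegular g ξ).le) (fun g => (norm_leftRegular g η).le)
    (fun g h => (inner_leftRegular g h ξ η).symm)

/-- The coefficient of `δ₁` against the conjugate of `u` is `u`, because `λ(g)δ₁ = δ_g`. -/
theorem memFourierAlgebra_of_finite_support {Γ : Type*} [Group Γ] {u : Γ → ℂ}
    (hu : (Function.support u).Finite) : MemFourierAlgebra u := by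
  classical
  let η : lp (fun _ : Γ => ℂ) 2 := ∑ k ∈ hu.toFinset, lp.single 2 k ((starRingEnd ℂ) (u k))
  refine ⟨lp.single 2 1 1, η, fun g => ?_⟩
  have h1 : leftRegular g (lp.single 2 (1 : Γ) (1 : ℂ)) = lp.single 2 g (1 : ℂ) := by
    ext k
    simp only [leftRegular, lp.coeFn_single, Pi.single_apply]
    simp [inv_mul_eq_one, eq_comm]
  rw [h1, lp.inner_single_right]
  have h2 : η g = (starRingEnd ℂ) (u g) := by
    simp only [η, lp.coeFn_sum, Finset.sum_apply, lp.coeFn_single, Pi.single_apply]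
    simp only [Finset.sum_ite_eq, Set.Finite.mem_toFinset, Function.mem_support]
    split_ifs with h
    · rfl
    · simp at h; simp [h]
  rw [h2]; simp

theorem lp_exists_finite_support_norm_sub_lt {Γ : Type*} (ξ : lp (fun _ : Γ => ℂ) 2) {ε : ℝ}
    (hε : 0 < ε) : ∃ ξ' : lp (fun _ : Γ => ℂ) 2,
      (Function.support (ξ' : Γ → ℂ)).Finite ∧ ‖ξ' - ξ‖ < ε := by
  classical
  have h := lp.hasSum_single (p := 2) (by norm_num) ξ
  obtain ⟨s, hs⟩ := (Metric.tendsto_nhds.1 h ε hε).exists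
  refine ⟨_, ?_, by rwa [dist_eq_norm] at hs⟩
  refine s.finite_toSet.subset fun k hk => ?_
  by_contra hks
  refine hk ?_
  simp only [lp.coeFn_sum, Finset.sum_apply, lp.coeFn_single, Pi.single_apply]
  refine Finset.sum_eq_zero fun i hi => if_neg ?_
  rintro rfl; exact hks hi

theorem finite_support_coefficient {Γ : Type*} [Group Γ] {ξ η : lp (fun _ : Γ => ℂ) 2}
    (hξ : (Function.support (ξ : Γ → ℂ)).Finite) (hη : (Function.support (η : Γ → ℂ)).Finite) :
    (Function.support fun g => inner ℂ η (leftRegular g ξ)).Finite := by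
  refine (hη.image2 (fun a b => a * b⁻¹) hξ).subset fun g hg => ?_
  rw [Function.mem_support, lp.inner_eq_tsum] at hg
  obtain ⟨k, hk⟩ : ∃ k, inner ℂ (η k) (leftRegular g ξ k) ≠ 0 := by
    by_contra hcon
    push Not at hcon
    exact hg ((tsum_congr hcon).trans tsum_zero)
  refine ⟨k, fun h => hk (by simp [h]), g⁻¹ * k, fun h => hk ?_, by simp⟩
  have : leftRegular g ξ k = 0 := h
  rw [this, inner_zero_right]

/-- Elements of the Fourier algebra are approximated in the Herz-Schur norm by finitely supported
functions. -/
theorem MemFourierAlgebra.exists_finite_support {Γ : Type*} [Group Γ] [Countable Γ] {u : Γ → ℂ}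
    (hA : MemFourierAlgebra u) {ε : ℝ} (hε : 0 < ε) : ∃ v : Γ → ℂ,
      (Function.support v).Finite ∧ IsHerzSchur (v - u) ∧ herzSchurNorm (v - u) ≤ ε := by
  obtain ⟨ξ, η, hu⟩ := hA
  -- `η'` comes first, since the tolerance for `ξ'` involves `‖η'‖`; the `+ 1` guards against
  -- division by zero.
  have h1 : 0 < ε / 4 / (‖ξ‖ + 1) := by positivity
  obtain ⟨η', hη', hη'd⟩ := lp_exists_finite_support_norm_sub_lt η h1
  have h2 : 0 < ε / 4 / (‖η'‖ + 1) := by positivity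
  obtain ⟨ξ', hξ', hξ'd⟩ := lp_exists_finite_support_norm_sub_lt ξ h2
  refine ⟨_, finite_support_coefficient hξ' hη', ?_⟩
  have e : (fun g => inner ℂ η' (leftRegular g ξ')) - u =
      (fun g => inner ℂ η' (leftRegular g (ξ' - ξ))) +
        fun g => inner ℂ (η' - η) (leftRegular g ξ) := by
    funext g
    simp only [Pi.sub_apply, Pi.add_apply, hu, leftRegular_sub, inner_sub_left, inner_sub_right]
    ring
  obtain ⟨a1, a2⟩ := isHerzSchur_coefficient (ξ' - ξ) η'
  obtain ⟨b1, b2⟩ := isHerzSchur_coefficient ξ (η' - η)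
  rw [e]
  have h3 : ‖ξ' - ξ‖ * ‖η'‖ < ε / 2 := by
    have : ‖ξ' - ξ‖ * (‖η'‖ + 1) < ε / 4 := (lt_div_iff₀ (by positivity)).1 hξ'd
    nlinarith [norm_nonneg (ξ' - ξ)]
  have h4 : ‖ξ‖ * ‖η' - η‖ < ε / 2 := by
    have : ‖η' - η‖ * (‖ξ‖ + 1) < ε / 4 := (lt_div_iff₀ (by positivity)).1 hη'd
    nlinarith [norm_nonneg (η' - η)]
  have := a1.add b1 (a2.trans_lt h3) (b2.trans_lt h4) (by positivity) (by positivity)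
  exact ⟨this.1, this.2.trans (by linarith)⟩

/-! ### The dual of `L¹` and approximately invariant densities -/

theorem norm_toL1_eq_integral {Q : Type*} [MeasurableSpace Q] {μ : Measure Q} {f : Q → ℝ}
    (hf : Integrable f μ) : ‖hf.toL1 f‖ = ∫ x, |f x| ∂μ := by
  rw [L1.norm_eq_integral_norm]
  refine integral_congr_ae ?_
  filter_upwards [hf.coeFn_toL1] with x hx
  rw [hx, Real.norm_eq_abs]

/-- Continuous linear functionals on `L¹` of a σ-finite measure are given by bounded functions. -/
theorem exists_bounded_representative_of_dual_L1 {Q : Type*} [MeasurableSpace Q] (μ : Measure Q)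
    [SigmaFinite μ] (ℓ : Lp ℝ 1 μ →L[ℝ] ℝ) :
    ∃ (g : Q → ℝ) (M : ℝ), Measurable g ∧ (∀ x, |g x| ≤ M) ∧
      ∀ (f : Q → ℝ) (hf : Integrable f μ), ℓ (hf.toL1 f) = ∫ x, f x * g x ∂μ := by
  -- With `s = √w` in `L²` and positive everywhere, multiplication by `s` maps `L²` to `L¹`. The
  -- pulled-back functional has a Riesz representative `G`, and the function sought is `G / s`.
  obtain ⟨w, hw0, hwm, hwi⟩ := exists_pos_lintegral_lt_of_sigmaFinite μ one_ne_zero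
  let s : Q → ℝ := fun x => √(w x)
  have hs0 : ∀ x, 0 < s x := fun x => Real.sqrt_pos.2 (hw0 x)
  have hsm : Measurable s := hwm.coe_nnreal_real.sqrt
  have hs2 : ∀ x, s x ^ 2 = w x := fun x => Real.sq_sqrt (w x).2
  have hs2i : Integrable (fun x => s x ^ 2) μ := by
    refine ⟨(hsm.pow_const 2).aestronglyMeasurable, ?_⟩
    rw [hasFiniteIntegral_iff_enorm]
    refine lt_of_le_of_lt (lintegral_mono fun x => ?_) (hwi.trans ENNReal.one_lt_top)
    rw [hs2, Real.enorm_eq_ofReal NNReal.zero_le_coe, ENNReal.ofReal_coe_nnreal]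
  have hsL : MemLp s 2 μ := (memLp_two_iff_integrable_sq hsm.aestronglyMeasurable).2 hs2i
  let ℓ' : Lp ℝ 2 μ →L[ℝ] ℝ :=
    ℓ.comp ((ContinuousLinearMap.mul ℝ ℝ).holderL μ 2 2 1 (hsL.toLp s))
  let G : Lp ℝ 2 μ := (InnerProductSpace.toDual ℝ (Lp ℝ 2 μ)).symm ℓ'
  have hGm : Measurable G := (Lp.stronglyMeasurable G).measurable
  have hGL : MemLp G 2 μ := Lp.memLp G
  have key1 : ∀ (h : Q → ℝ) (_ : MemLp h 2 μ) (f : Q → ℝ) (hf : Integrable f μ),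
      (∀ x, f x = s x * h x) → ℓ (hf.toL1 f) = ∫ x, G x * h x ∂μ := by
    intro h hh f hf hfs
    have e1 : ℓ' (hh.toLp h) = ∫ x, G x * h x ∂μ := by
      rw [← InnerProductSpace.toDual_symm_apply, L2.inner_def]
      refine integral_congr_ae ?_
      filter_upwards [hh.coeFn_toLp] with x hx
      simp only [hx]
      simp [G, mul_comm]
    rw [← e1]
    simp only [ℓ', ContinuousLinearMap.comp_apply]
    congr 1
    refine Lp.ext ?_
    filter_upwards [hf.coeFn_toL1, (ContinuousLinearMap.mul ℝ ℝ).coeFn_holder (r := 1)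
      (hsL.toLp s) (hh.toLp h), hsL.coeFn_toLp, hh.coeFn_toLp] with x h1 h2 h3 h4
    rw [h1, ContinuousLinearMap.holderL_apply_apply, h2, h3, h4, hfs]
    rfl
  set M := ‖ℓ‖
  have hGs : Integrable (fun x => G x * s x) μ := hGL.integrable_mul hsL
  -- Testing `ℓ` on `s² 1_A`, of `L¹` norm `∫_A s²`, yields `|G| ≤ ‖ℓ‖ s` almost everywhere.
  have hset : ∀ A, MeasurableSet A →
      |∫ x in A, G x * s x ∂μ| ≤ ∫ x in A, M * s x ^ 2 ∂μ := by
    intro A hA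
    have hi : Integrable (A.indicator fun x => s x ^ 2) μ := hs2i.indicator hA
    have h1 := key1 (A.indicator s) (hsL.indicator hA) _ hi (fun x => by
      by_cases hx : x ∈ A <;> simp [hx, pow_two])
    have h2 : ∫ x, G x * A.indicator s x ∂μ = ∫ x in A, G x * s x ∂μ := by
      rw [← integral_indicator hA]
      refine integral_congr_ae (Eventually.of_forall fun x => ?_)
      by_cases hx : x ∈ A <;> simp [hx]
    rw [← h2, ← h1, ← Real.norm_eq_abs]
    refine (ℓ.le_opNorm _).trans (le_of_eq ?_)
    rw [norm_toL1_eq_integral, integral_const_mul, ← integral_indicator hA]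
    congr 2
    funext x
    by_cases hx : x ∈ A <;> simp [hx]
  have hub : ∀ᵐ x ∂μ, G x * s x ≤ M * s x ^ 2 :=
    ae_le_of_forall_setIntegral_le hGs (hs2i.const_mul M)
      fun A hA _ => (le_abs_self _).trans (hset A hA)
  have hlb : ∀ᵐ x ∂μ, -(G x * s x) ≤ M * s x ^ 2 := by
    refine ae_le_of_forall_setIntegral_le hGs.neg (hs2i.const_mul M) fun A hA _ => ?_
    rw [integral_neg]
    exact (neg_le_abs _).trans (hset A hA)
  -- Clamping makes the bound hold everywhere and changes `G / s` only on a null set.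
  let g : Q → ℝ := fun x => max (-M) (min M (G x / s x))
  have hM : 0 ≤ M := norm_nonneg ℓ
  have hgm : Measurable g := measurable_const.max (measurable_const.min (hGm.div hsm))
  have hgb : ∀ x, |g x| ≤ M := fun x =>
    abs_le.2 ⟨le_max_left _ _, max_le (by linarith) (min_le_left _ _)⟩
  have hgG : ∀ᵐ x ∂μ, g x = G x / s x := by
    filter_upwards [hub, hlb] with x h1 h2
    have h3 : G x / s x ≤ M := by
      rw [div_le_iff₀ (hs0 x)]; nlinarith [hs0 x]
    have h4 : -M ≤ G x / s x := by
      rw [le_div_iff₀ (hs0 x)]; nlinarith [hs0 x]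
    simp only [g]
    rw [min_eq_right h3, max_eq_right h4]
  refine ⟨g, M, hgm, hgb, fun f hf => ?_⟩
  wlog hfm : Measurable f generalizing f
  · obtain ⟨f', hf', hff'⟩ := hf.1.aemeasurable
    have hfi : Integrable f' μ := hf.congr hff'
    have := this f' hfi hf'
    rw [(Integrable.toL1_eq_toL1_iff f f' hf hfi).2 hff', this]
    refine integral_congr_ae ?_
    filter_upwards [hff'] with x hx
    rw [hx]
  -- On `A n` the quotient `f / s` is at most `n s`, hence in `L²`, where the formula is known;
  -- dominated convergence then removes the truncation.
  let A : ℕ → Set Q := fun n => {x | |f x| ≤ n * s x ^ 2}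
  have hA : ∀ n, MeasurableSet (A n) := fun n =>
    measurableSet_le hfm.abs ((hsm.pow_const 2).const_mul _)
  have hfi : ∀ n, Integrable ((A n).indicator f) μ := fun n => hf.indicator (hA n)
  have hev : ∀ x, ∀ᶠ n in atTop, (A n).indicator f x = f x := by
    intro x
    obtain ⟨N, hN⟩ := exists_nat_ge (|f x| / s x ^ 2)
    filter_upwards [eventually_ge_atTop N] with n hn
    refine Set.indicator_of_mem ?_ _
    have : |f x| / s x ^ 2 ≤ n := hN.trans (by exact_mod_cast hn)
    rwa [div_le_iff₀ (by have := hs0 x; positivity)] at this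
  have hle : ∀ n x, |(A n).indicator f x| ≤ |f x| := by
    intro n x
    by_cases hx : x ∈ A n <;> simp [hx]
  have hkey : ∀ n, ℓ ((hfi n).toL1 _) = ∫ x, (A n).indicator f x * g x ∂μ := by
    intro n
    have hm : Measurable (fun x => (A n).indicator f x / s x) := (hfm.indicator (hA n)).div hsm
    have hL : MemLp (fun x => (A n).indicator f x / s x) 2 μ := by
      refine (hsL.const_mul (n : ℝ)).mono hm.aestronglyMeasurable
        (Eventually.of_forall fun x => ?_)
      have hsx := hs0 x
      by_cases hx : x ∈ A n
      · have hx' : |f x| ≤ n * s x ^ 2 := hx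
        simp only [hx, Set.indicator_of_mem, Real.norm_eq_abs, abs_div, abs_mul, abs_of_pos hsx,
          Nat.abs_cast]
        rw [div_le_iff₀ hsx]; nlinarith
      · simp only [hx, not_false_eq_true, Set.indicator_of_notMem, zero_div, norm_zero]
        positivity
    rw [key1 _ hL _ (hfi n) (fun x => by have := (hs0 x).ne'; field_simp)]
    refine integral_congr_ae ?_
    filter_upwards [hgG] with x hx
    rw [hx]; ring
  have hlim1 : Tendsto (fun n => ℓ ((hfi n).toL1 _)) atTop (𝓝 (ℓ (hf.toL1 f))) := by
    refine (ℓ.continuous.tendsto _).comp ?_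
    rw [tendsto_iff_norm_sub_tendsto_zero]
    have h0 : Tendsto (fun n => ∫ x, |(A n).indicator f x - f x| ∂μ) atTop
        (𝓝 (∫ _, (0 : ℝ) ∂μ)) := by
      refine tendsto_integral_of_dominated_convergence (fun x => 2 * |f x|)
        (fun n => ((hfi n).sub hf).abs.1) (hf.abs.const_mul 2) (fun n => ?_) ?_
      · refine Eventually.of_forall fun x => ?_
        rw [Real.norm_eq_abs, abs_abs]
        have := hle n x
        refine (abs_sub _ _).trans ?_
        linarith
      · refine Eventually.of_forall fun x => ?_
        refine tendsto_const_nhds.congr' ?_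
        filter_upwards [hev x] with n hn
        simp [hn]
    rw [integral_zero] at h0
    refine h0.congr fun n => ?_
    rw [← Integrable.toL1_sub, norm_toL1_eq_integral]
    rfl
  have hlim2 : Tendsto (fun n => ∫ x, (A n).indicator f x * g x ∂μ) atTop
      (𝓝 (∫ x, f x * g x ∂μ)) := by
    refine tendsto_integral_of_dominated_convergence (fun x => |f x| * M)
      (fun n => (hfi n).1.mul hgm.aestronglyMeasurable) (hf.abs.mul_const M) (fun n => ?_) ?_
    · refine Eventually.of_forall fun x => ?_
      rw [norm_mul]
      exact mul_le_mul (hle n x) (hgb x) (abs_nonneg _) (abs_nonneg _)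
    · refine Eventually.of_forall fun x => ?_
      refine tendsto_const_nhds.congr' ?_
      filter_upwards [hev x] with n hn
      rw [hn]
  exact tendsto_nhds_unique hlim1 (hlim2.congr fun n => (hkey n).symm)

/-- An amenable pair with an invariant σ-finite measure has approximately invariant probability
densities. -/
theorem IsAmenablePair.exists_almost_invariant_density {G Q : Type*} [Group G] [MulAction G Q]
    [MeasurableSpace Q] {μ : Measure Q} [SigmaFinite μ] [MeasurableConstSMul G Q]
    [SMulInvariantMeasure G Q μ] (hG : IsAmenablePair G Q μ) (K : Finset G) {ε : ℝ}
    (hε : 0 < ε) :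
    ∃ f : Q → ℝ, Measurable f ∧ (∀ x, 0 ≤ f x) ∧ Integrable f μ ∧ ∫ x, f x ∂μ = 1 ∧
      ∀ γ ∈ K, ∫ x, |f (γ⁻¹ • x) - f x| ∂μ < ε := by
  classical
  obtain ⟨-, φ, hφpos, hφone, hφinv⟩ := hG
  by_contra hcon
  push Not at hcon
  have htr : ∀ (γ : G) {f : Q → ℝ}, Integrable f μ → Integrable (fun x => f (γ • x)) μ :=
    fun γ f hf => (measurePreserving_smul γ μ).integrable_comp_of_integrable hf
  -- The displacement families of all probability densities form a convex set. If no density is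
  -- `ε`-invariant, this set misses the `ε`-ball of the sup norm on `L¹` families and can be
  -- separated from it.
  let C : Set (K → Lp ℝ 1 μ) := {z | ∃ (f : Q → ℝ) (_ : Measurable f) (_ : ∀ x, 0 ≤ f x)
    (hf : Integrable f μ) (_ : ∫ x, f x ∂μ = 1),
    z = fun γ : K => ((htr (γ : G)⁻¹ hf).sub hf).toL1 _}
  have hCconv : Convex ℝ C := by
    rintro _ ⟨f, hfm, hf0, hfi, hf1, rfl⟩ _ ⟨g, hgm, hg0, hgi, hg1, rfl⟩ a b ha hb hab
    refine ⟨fun x => a * f x + b * g x, (hfm.const_mul a).add (hgm.const_mul b),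
      fun x => by have := hf0 x; have := hg0 x; positivity,
      (hfi.const_mul a).add (hgi.const_mul b), ?_, ?_⟩
    · rw [integral_add (hfi.const_mul a) (hgi.const_mul b), integral_const_mul,
        integral_const_mul, hf1, hg1]
      linarith
    · funext γ
      simp only [Pi.add_apply, Pi.smul_apply]
      rw [← Integrable.toL1_smul, ← Integrable.toL1_smul, ← Integrable.toL1_add]
      rw [Integrable.toL1_eq_toL1_iff]
      refine Eventually.of_forall fun x => ?_
      simp only [Pi.add_apply, Pi.sub_apply, smul_eq_mul]
      ring
  have hdisj : Disjoint (Metric.ball (0 : K → Lp ℝ 1 μ) ε) C := by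
    rw [Set.disjoint_left]
    rintro _ hz ⟨f, hfm, hf0, hfi, hf1, rfl⟩
    obtain ⟨γ, hγ, hle⟩ := hcon f hfm hf0 hfi hf1
    rw [mem_ball_zero_iff] at hz
    have h1 := (norm_le_pi_norm _ (⟨γ, hγ⟩ : K)).trans_lt hz
    simp only at h1
    rw [norm_toL1_eq_integral] at h1
    exact absurd h1 (not_lt.2 hle)
  obtain ⟨ℓ, c, hball, hC⟩ := geometric_hahn_banach_open (convex_ball _ _) Metric.isOpen_ball
    hCconv hdisj
  have hc : 0 < c := by simpa using hball 0 (Metric.mem_ball_self hε)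
  choose g M hgm hgb hgr using fun γ : K => exists_bounded_representative_of_dual_L1 μ
    (ℓ.comp (ContinuousLinearMap.single ℝ (fun _ : K => Lp ℝ 1 μ) γ))
  -- Moving the translations from `f` to the functions `g γ` expresses the separating functional as
  -- `f ↦ ∫ f D`.
  let D : Q → ℝ := fun x => ∑ γ : K, (g γ ((γ : G) • x) - g γ x)
  have hgm' : ∀ γ : K, Measurable fun x => g γ ((γ : G) • x) := fun γ =>
    (hgm γ).comp (measurable_const_smul (γ : G))
  have hDm : Measurable D := Finset.measurable_fun_sum _ fun γ _ => (hgm' γ).sub (hgm γ)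
  have hDb : ∀ x, |D x| ≤ ∑ γ : K, 2 * M γ := fun x => by
    refine (Finset.abs_sum_le_sum_abs _ _).trans (Finset.sum_le_sum fun γ _ => ?_)
    refine (abs_sub _ _).trans ?_
    linarith [hgb γ ((γ : G) • x), hgb γ x]
  have hbdd : ∀ {f h : Q → ℝ} {B : ℝ}, Integrable f μ → Measurable h → (∀ x, |h x| ≤ B) →
      Integrable (fun x => f x * h x) μ := fun hf hm hb =>
    hf.mul_bdd hm.aestronglyMeasurable (Eventually.of_forall hb)
  have hpair : ∀ f : Q → ℝ, Measurable f → (∀ x, 0 ≤ f x) → Integrable f μ →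
      ∫ x, f x ∂μ = 1 → c ≤ ∫ x, f x * D x ∂μ := by
    intro f hfm hf0 hfi hf1
    refine (hC _ ⟨f, hfm, hf0, hfi, hf1, rfl⟩).trans (le_of_eq ?_)
    rw [← ContinuousLinearMap.sum_comp_single]
    simp only [D, Finset.mul_sum]
    rw [integral_finsetSum]
    · refine Finset.sum_congr rfl fun γ _ => ?_
      have h := hgr γ _ ((htr (γ : G)⁻¹ hfi).sub hfi)
      simp only [ContinuousLinearMap.comp_apply] at h ⊢
      rw [h]
      simp only [Pi.sub_apply, sub_mul, mul_sub]
      rw [integral_sub (hbdd (htr _ hfi) (hgm γ) (hgb γ)) (hbdd hfi (hgm γ) (hgb γ)),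
        integral_sub (hbdd hfi (hgm' γ) fun x => hgb γ _) (hbdd hfi (hgm γ) (hgb γ))]
      congr 1
      rw [← integral_smul_eq_self _ (g := (γ : G))]
      simp
    · exact fun γ _ => hbdd hfi ((hgm' γ).sub (hgm γ)) (B := 2 * M γ) fun x => by
        refine (abs_sub _ _).trans ?_
        linarith [hgb γ ((γ : G) • x), hgb γ x]
  -- Apply `hpair` to the normalized indicators of sets of finite positive measure.
  have hDc : ∀ᵐ x ∂μ, 0 ≤ D x - c := by
    refine ae_nonneg_of_forall_setIntegral_nonneg_of_sigmaFinite (fun A hA hAf => ?_)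
      (fun A hA hAf => ?_)
    · refine Measure.integrableOn_of_bounded hAf.ne (hDm.sub_const c).aestronglyMeasurable
        (M := (∑ γ : K, 2 * M γ) + c) (Eventually.of_forall fun x => ?_)
      refine (abs_sub _ _).trans ?_
      rw [abs_of_pos hc]
      linarith [hDb x]
    · have hDA : IntegrableOn D A μ := Measure.integrableOn_of_bounded hAf.ne
        hDm.aestronglyMeasurable (Eventually.of_forall hDb)
      rw [integral_sub hDA (integrableOn_const hAf.ne), setIntegral_const, smul_eq_mul]
      by_cases hA0 : μ A = 0
      · rw [Measure.restrict_eq_zero.2 hA0, integral_zero_measure]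
        simp [Measure.real, hA0]
      have hpos : 0 < μ.real A := ENNReal.toReal_pos hA0 hAf.ne
      have h := hpair (A.indicator fun _ => (μ.real A)⁻¹) (measurable_const.indicator hA)
        (fun x => Set.indicator_nonneg (fun _ _ => by positivity) x)
        ((integrable_indicator_iff hA).2 (integrableOn_const hAf.ne))
        (by rw [integral_indicator hA, setIntegral_const, smul_eq_mul, mul_inv_cancel₀ hpos.ne'])
      have h2 : ∫ x, (A.indicator (fun _ => (μ.real A)⁻¹) x) * D x ∂μ =
          (μ.real A)⁻¹ * ∫ x in A, D x ∂μ := by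
        rw [← integral_const_mul, ← integral_indicator hA]
        congr 1
        funext x
        by_cases hx : x ∈ A <;> simp [hx]
      rw [h2, inv_mul_eq_div, le_div_iff₀ hpos] at h
      linarith
  have hmem : ∀ {h : Q → ℝ} {B : ℝ}, Measurable h → (∀ x, |h x| ≤ B) →
      MemLp (fun x => (h x : ℂ)) ∞ μ := fun hm hb =>
    memLp_top_of_bound (Complex.measurable_ofReal.comp hm).aestronglyMeasurable _
      (Eventually.of_forall fun x => by rw [Complex.norm_real]; exact hb x)
  let a : K → Lp ℂ ∞ μ := fun γ => (hmem (hgm' γ) fun x => hgb γ _).toLp _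
  let b : K → Lp ℂ ∞ μ := fun γ => (hmem (hgm γ) (hgb γ)).toLp _
  let e : Lp ℂ ∞ μ := (hmem (measurable_const (a := (1 : ℝ))) (fun _ => le_refl _)).toLp _
  have hab : ∀ γ, φ (a γ) = φ (b γ) := fun γ => by
    refine hφinv (γ : G) _ _ ?_
    have hq := (measurePreserving_smul (γ : G) μ).quasiMeasurePreserving.ae
      (hmem (hgm γ) (hgb γ)).coeFn_toLp
    filter_upwards [hq, (hmem (hgm' γ) fun x => hgb γ _).coeFn_toLp] with x h1 h2
    rw [h1, h2]
  have he : φ e = 1 := hφone e (by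
    filter_upwards [(hmem (measurable_const (a := (1 : ℝ))) (fun _ => le_refl _)).coeFn_toLp
      (μ := μ)] with x hx
    rw [hx]; simp)
  -- The contradiction: invariance gives `φ(D) = 0`, whereas `D ≥ c` gives `φ(D) ≥ c > 0`.
  have hDe : 0 ≤ φ ((∑ γ, (a γ - b γ)) - (c : ℂ) • e) := by
    refine hφpos _ ?_
    have hsum : ⇑(∑ γ, (a γ - b γ)) =ᵐ[μ] fun x => (D x : ℂ) := by
      have h1 : (∑ γ, (a γ - b γ)) = (hmem hDm hDb).toLp _ := by
        have h2 : ∀ γ, a γ - b γ = (hmem ((hgm' γ).sub (hgm γ)) (B := 2 * M γ) (fun x => by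
            refine (abs_sub _ _).trans ?_
            linarith [hgb γ ((γ : G) • x), hgb γ x])).toLp _ := fun γ => by
          rw [← MemLp.toLp_sub]
          refine MemLp.toLp_congr _ _ (Eventually.of_forall fun x => ?_)
          simp
        refine Lp.ext ?_
        refine (Lp.coeFn_finsetSum _ _).trans ?_
        have h3 : ∀ᵐ x ∂μ, ∀ γ, (a γ - b γ : Lp ℂ ∞ μ) x =
            ((g γ ((γ : G) • x) - g γ x : ℝ) : ℂ) := by
          rw [ae_all_iff]
          intro γ
          rw [h2 γ]
          exact MemLp.coeFn_toLp _
        filter_upwards [h3, (hmem hDm hDb).coeFn_toLp] with x h4 h5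
        rw [h5]
        simp only [Finset.sum_apply, h4, D, Complex.ofReal_sum]
      rw [h1]
      exact MemLp.coeFn_toLp _
    filter_upwards [hsum, hDc, Lp.coeFn_sub (∑ γ, (a γ - b γ)) ((c : ℂ) • e),
      Lp.coeFn_smul (c : ℂ) e,
      (hmem (measurable_const (a := (1 : ℝ))) (fun _ => le_refl _)).coeFn_toLp (μ := μ)]
      with x h1 h2 h3 h4 h5
    rw [h3, Pi.sub_apply, h1, h4, Pi.smul_apply, h5]
    simp only [Complex.ofReal_one, smul_eq_mul, mul_one]
    exact_mod_cast h2
  rw [map_sub, map_sum, map_smul, he] at hDe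
  simp only [map_sub, hab, sub_self, Finset.sum_const_zero, zero_sub, smul_eq_mul, mul_one] at hDe
  have : (0 : ℝ) ≤ -c := by exact_mod_cast hDe
  linarith

/-! ### Measurable equivariant sections of a coupling -/

theorem stronglyMeasurable_comp_of_countable {S ι E : Type*} [MeasurableSpace S] [Countable ι]
    [TopologicalSpace E] {T : S → ι} (hT : ∀ i, MeasurableSet (T ⁻¹' {i})) (φ : ι → E) :
    StronglyMeasurable fun s => φ (T s) := by
  let _ : MeasurableSpace ι := ⊤
  exact (StronglyMeasurable.of_discrete (f := φ)).comp_measurable (measurable_to_countable' hT)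

open scoped Pointwise in
/-- A fundamental domain gives a measurable equivariant map to the group, off an invariant null
set. -/
theorem MeasureTheory.IsFundamentalDomain.exists_equivariant_map {G S : Type*} [Group G]
    [Countable G] [MulAction G S] [MeasurableSpace S] [MeasurableConstSMul G S] {σ : Measure S}
    [SMulInvariantMeasure G S σ] {X : Set S} (hX : IsFundamentalDomain G X σ) :
    ∃ (θ : S → G) (N : Set S), (∀ g, MeasurableSet (θ ⁻¹' {g})) ∧ MeasurableSet N ∧ σ N = 0 ∧
      (∀ (g : G) s, s ∉ N → g • s ∉ N) ∧ (∀ (g : G) s, s ∉ N → θ (g • s) = g * θ s) ∧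
      X =ᵐ[σ] {s | θ s = 1} := by
  classical
  obtain ⟨X', hX'm, hXX'⟩ := hX.nullMeasurableSet
  -- The measurable replacement `X'` meets an orbit exactly once only almost everywhere. `P` selects
  -- the points where it does; it is exactly invariant, so equivariance holds everywhere off its
  -- complement.
  let P : S → Prop := fun s => ∃! g : G, g⁻¹ • s ∈ X'
  have hA : ∀ g : G, MeasurableSet {s | g⁻¹ • s ∈ X'} := fun g =>
    measurable_const_smul g⁻¹ hX'm
  have hPset : {s | P s} = (⋃ g : G, {s | g⁻¹ • s ∈ X'}) \
      ⋃ (g : G) (h : G) (_ : g ≠ h), {s | g⁻¹ • s ∈ X'} ∩ {s | h⁻¹ • s ∈ X'} := by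
    ext s
    simp only [P, Set.mem_ofPred_eq, Set.mem_sdiff, Set.mem_iUnion, Set.mem_inter_iff, not_exists]
    constructor
    · rintro ⟨g, hg, hu⟩
      exact ⟨⟨g, hg⟩, fun a b hab h => hab ((hu a h.1).trans (hu b h.2).symm)⟩
    · rintro ⟨⟨g, hg⟩, hu⟩
      exact ⟨g, hg, fun k hk => by_contra fun hne => hu k g hne ⟨hk, hg⟩⟩
  have hPm : MeasurableSet {s | P s} := by
    rw [hPset]
    exact (MeasurableSet.iUnion hA).diff (MeasurableSet.iUnion fun g => MeasurableSet.iUnion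
      fun h => MeasurableSet.iUnion fun _ => (hA g).inter (hA h))
  have hPinv : ∀ (g : G) s, P s → P (g • s) := by
    rintro g s ⟨k, hk, hu⟩
    refine ⟨g * k, by simpa [smul_smul] using hk, fun l hl => ?_⟩
    have := hu (g⁻¹ * l) (by simpa [smul_smul] using hl)
    rw [← this]; group
  have hXX'a : ∀ᵐ s ∂σ, ∀ g : G, g⁻¹ • s ∈ X' ↔ g⁻¹ • s ∈ X := by
    rw [ae_all_iff]
    intro g
    filter_upwards [(measurePreserving_smul g⁻¹ σ).quasiMeasurePreserving.ae hXX'] with s hs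
    exact (iff_of_eq hs).symm
  have hPae : ∀ᵐ s ∂σ, P s := by
    have hdis : ∀ᵐ s ∂σ, ∀ g h : G, g ≠ h → ¬ (s ∈ g • X ∧ s ∈ h • X) := by
      rw [ae_all_iff]; intro g
      rw [ae_all_iff]; intro h
      by_cases hgh : g = h
      · simp [hgh]
      · have h0 : σ (g • X ∩ h • X) = 0 := hX.aedisjoint hgh
        filter_upwards [measure_eq_zero_iff_ae_notMem.1 h0] with s hs _
        exact hs
    filter_upwards [hXX'a, hdis, hX.ae_covers] with s h1 h2 ⟨g, hg⟩
    refine ⟨g⁻¹, (h1 g⁻¹).2 (by simpa using hg), fun k hk => ?_⟩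
    by_contra hne
    refine h2 _ _ hne ⟨?_, ?_⟩
    · rw [Set.mem_smul_set_iff_inv_smul_mem]; exact (h1 k).1 hk
    · rw [Set.mem_smul_set_iff_inv_smul_mem]; simpa using hg
  let θ : S → G := fun s => if h : P s then h.choose else 1
  have hθ : ∀ s, P s → ∀ g : G, θ s = g ↔ g⁻¹ • s ∈ X' := by
    intro s hs g
    simp only [θ, dif_pos hs]
    have := hs.choose_spec
    refine ⟨fun h => h ▸ this.1, fun h => (this.2 g h).symm⟩
  refine ⟨θ, {s | P s}ᶜ, fun g => ?_, hPm.compl, hPae, fun g s hs hgs => ?_, fun g s hs => ?_, ?_⟩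
  · have : θ ⁻¹' {g} = ({s | P s} ∩ {s | g⁻¹ • s ∈ X'}) ∪ ({s | P s}ᶜ ∩ {_s | (1 : G) = g}) := by
      ext s
      by_cases hs : P s
      · simp [hs, hθ s hs]
      · simp [hs, θ]
    rw [this]
    exact (hPm.inter (hA g)).union (hPm.compl.inter (MeasurableSet.const _))
  · exact hgs (hPinv g s (by simpa using hs))
  · have hs' : P s := by simpa using hs
    rw [hθ _ (hPinv g s hs')]
    have := (hθ s hs' (θ s)).1 rfl
    simpa [smul_smul] using this
  · filter_upwards [hPae, hXX'] with s h1 h2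
    have h3 : (s ∈ X) = (s ∈ X') := h2
    refine h3.trans (propext ?_)
    have := hθ s h1 1
    rw [inv_one, one_smul] at this
    exact this.symm

/-- Measurable maps from a coupling to both groups which are equivariant off an invariant null
set. -/
structure EquivariantSections (Γ Δ : Type*) {S : Type*} [Group Γ] [Group Δ] [MeasurableSpace S]
    [MulAction Γ S] [MulAction Δ S] (σ : Measure S) where
  /-- The `Δ`-equivariant map. -/
  θ : S → Δ
  /-- The `Γ`-equivariant map. -/
  κ : S → Γ
  /-- The exceptional null set. -/
  N : Set S
  measurable_θ : ∀ δ, MeasurableSet (θ ⁻¹' {δ})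
  measurable_κ : ∀ γ, MeasurableSet (κ ⁻¹' {γ})
  measurable_N : MeasurableSet N
  null_N : σ N = 0
  left_notMem : ∀ (γ : Γ) s, s ∉ N → γ • s ∉ N
  right_notMem : ∀ (δ : Δ) s, s ∉ N → δ • s ∉ N
  θ_smul : ∀ (δ : Δ) s, s ∉ N → θ (δ • s) = δ * θ s
  κ_smul : ∀ (γ : Γ) s, s ∉ N → κ (γ • s) = γ * κ s

/-- Each exceptional set is invariant under its own group. Saturating it under the other, countable
group keeps it null, and since the actions commute the union is invariant under both. -/
theorem exists_equivariantSections {Γ Δ S : Type*} [Group Γ] [Group Δ] [Countable Γ] [Countable Δ]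
    [MeasurableSpace S] [MulAction Γ S] [MulAction Δ S] [SMulCommClass Γ Δ S]
    [MeasurableConstSMul Γ S] [MeasurableConstSMul Δ S] {σ : Measure S}
    [SMulInvariantMeasure Γ S σ] [SMulInvariantMeasure Δ S σ] {X Y : Set S}
    (hX : IsFundamentalDomain Δ X σ) (hY : IsFundamentalDomain Γ Y σ) :
    ∃ D : EquivariantSections Γ Δ σ, X =ᵐ[σ] {s | D.θ s = 1} := by
  obtain ⟨θ, N₁, a1, a2, a3, a4, a5, a6⟩ := hX.exists_equivariant_map
  obtain ⟨κ, N₂, b1, b2, b3, b4, b5, -⟩ := hY.exists_equivariant_map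
  have hmem : ∀ s, s ∉ (⋃ γ : Γ, {s | γ • s ∈ N₁}) ∪ (⋃ δ : Δ, {s | δ • s ∈ N₂}) ↔
      (∀ γ : Γ, γ • s ∉ N₁) ∧ ∀ δ : Δ, δ • s ∉ N₂ := fun s => by simp
  refine ⟨⟨θ, κ, (⋃ γ : Γ, {s | γ • s ∈ N₁}) ∪ (⋃ δ : Δ, {s | δ • s ∈ N₂}), a1, b1, ?_, ?_, ?_,
    ?_, ?_, ?_⟩, a6⟩
  · exact (MeasurableSet.iUnion fun γ => measurable_const_smul γ a2).union
      (MeasurableSet.iUnion fun δ => measurable_const_smul δ b2)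
  · refine measure_union_null (measure_iUnion_null fun γ => ?_) (measure_iUnion_null fun δ => ?_)
    · exact ((measurePreserving_smul γ σ).measure_preimage a2.nullMeasurableSet).trans a3
    · exact ((measurePreserving_smul δ σ).measure_preimage b2.nullMeasurableSet).trans b3
  · intro γ s hs
    rw [hmem] at hs ⊢
    refine ⟨fun γ' => ?_, fun δ => ?_⟩
    · rw [smul_smul]; exact hs.1 _
    · rw [← smul_comm]; exact b4 _ _ (hs.2 δ)
  · intro δ s hs
    rw [hmem] at hs ⊢
    refine ⟨fun γ => ?_, fun δ' => ?_⟩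
    · rw [smul_comm]; exact a4 _ _ (hs.1 γ)
    · rw [smul_smul]; exact hs.2 _
  · intro δ s hs
    exact a5 δ s (by simpa using ((hmem s).1 hs).1 1)
  · intro γ s hs
    exact b5 γ s (by simpa using ((hmem s).1 hs).2 1)

/-! ### Integrals of `Δ`-invariant functions over the fundamental domain -/

namespace EquivariantSections

variable {Γ Δ S : Type*} [Group Γ] [Group Δ] [MeasurableSpace S] [MulAction Γ S] [MulAction Δ S]
  {σ : Measure S}

/-- The fundamental domain of `Δ` attached to the equivariant map. -/
def domain (D : EquivariantSections Γ Δ σ) : Set S := {s | D.θ s = 1}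

theorem measurableSet_domain (D : EquivariantSections Γ Δ σ) : MeasurableSet D.domain :=
  D.measurable_θ 1

theorem ae_notMem (D : EquivariantSections Γ Δ σ) : ∀ᵐ s ∂σ, s ∉ D.N :=
  measure_eq_zero_iff_ae_notMem.1 D.null_N

theorem isFundamentalDomain_domain (D : EquivariantSections Γ Δ σ) :
    IsFundamentalDomain Δ D.domain σ where
  nullMeasurableSet := D.measurableSet_domain.nullMeasurableSet
  ae_covers := by
    filter_upwards [D.ae_notMem] with s hs
    exact ⟨(D.θ s)⁻¹, by simp [domain, D.θ_smul _ _ hs]⟩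
  aedisjoint := by
    intro g h hgh
    refine measure_mono_null ?_ D.null_N
    rintro s ⟨h1, h2⟩
    by_contra hs
    simp only [Set.mem_smul_set_iff_inv_smul_mem, domain, Set.mem_ofPred_eq,
      D.θ_smul _ _ hs] at h1 h2
    exact hgh ((inv_mul_eq_one.1 h1).trans (inv_mul_eq_one.1 h2).symm)

variable [SMulCommClass Γ Δ S] [MeasurableConstSMul Γ S] [SMulInvariantMeasure Γ S σ]

theorem isFundamentalDomain_smul (D : EquivariantSections Γ Δ σ) (γ : Γ) :
    IsFundamentalDomain Δ ((fun s : S => γ⁻¹ • s) ⁻¹' D.domain) σ := by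
  refine D.isFundamentalDomain_domain.preimage_of_equiv (f := fun s : S => γ⁻¹ • s)
    (measurePreserving_smul γ⁻¹ σ).quasiMeasurePreserving (e := id) Function.bijective_id ?_
  intro δ s
  exact smul_comm _ _ _

variable [Countable Δ] [MeasurableConstSMul Δ S] [SMulInvariantMeasure Δ S σ]

/-- A change of variables moves the domain to its translate by `γ`, again a `Δ`-fundamental domain,
and an invariant function has the same integral over both. This is the invariance of the measure on
`S/Δ`. -/
theorem integral_smul {E : Type*} [NormedAddCommGroup E] [NormedSpace ℝ E]
    (D : EquivariantSections Γ Δ σ) {f : S → E} (hf : ∀ (δ : Δ) s, f (δ • s) = f s) (γ : Γ) :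
    ∫ x in D.domain, f (γ • x) ∂σ = ∫ x in D.domain, f x ∂σ := by
  have := (measurePreserving_smul γ σ).setIntegral_preimage_emb
    (measurableEmbedding_const_smul γ) f ((fun s : S => γ⁻¹ • s) ⁻¹' D.domain)
  rw [D.isFundamentalDomain_domain.setIntegral_eq (D.isFundamentalDomain_smul γ) hf, ← this]
  simp [Set.preimage_preimage]

theorem integrableOn_smul {E : Type*} [NormedAddCommGroup E]
    (D : EquivariantSections Γ Δ σ) {f : S → E} (hf : ∀ (δ : Δ) s, f (δ • s) = f s)
    (hi : IntegrableOn f D.domain σ) (γ : Γ) :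
    IntegrableOn (fun x => f (γ • x)) D.domain σ := by
  rw [D.isFundamentalDomain_domain.integrableOn_iff (D.isFundamentalDomain_smul γ) hf] at hi
  have := ((measurePreserving_smul γ σ).integrableOn_comp_preimage
    (measurableEmbedding_const_smul γ)).2 hi
  simpa [Set.preimage_preimage, Function.comp_def] using this

end EquivariantSections

/-! ### Weights and the induction of functions from `Δ` to `Γ` -/

namespace EquivariantSections

variable {Γ Δ S : Type*} [Group Γ] [Group Δ] [MeasurableSpace S] [MulAction Γ S] [MulAction Δ S]
  {σ : Measure S}

/-- A nonnegative `Δ`-invariant function, square integrable with integral at most `1` on the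
fundamental domain, and vanishing on the exceptional null set. -/
structure Weight (D : EquivariantSections Γ Δ σ) where
  /-- The function. -/
  F : S → ℝ
  measurable : Measurable F
  nonneg : ∀ s, 0 ≤ F s
  right_smul : ∀ (δ : Δ) s, F (δ • s) = F s
  eq_zero : ∀ s ∈ D.N, F s = 0
  integrableOn_sq : IntegrableOn (fun s => F s ^ 2) D.domain σ
  integral_sq_le : ∫ s in D.domain, F s ^ 2 ∂σ ≤ 1

/-- The function on `Γ` induced from a function `u` on `Δ`. -/
noncomputable def transfer (D : EquivariantSections Γ Δ σ) (W : D.Weight) (u : Δ → ℂ) (γ : Γ) :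
    ℂ :=
  ∫ x in D.domain, ((W.F (γ⁻¹ • x) * W.F x : ℝ) : ℂ) * u ((D.θ x)⁻¹ * D.θ (γ⁻¹ • x)) ∂σ

theorem notMem_of_smul (D : EquivariantSections Γ Δ σ) (γ : Γ) {s : S} (hs : γ • s ∉ D.N) :
    s ∉ D.N := by
  simpa using D.left_notMem γ⁻¹ _ hs

theorem stronglyMeasurable_θ_pair [Countable Δ] [MeasurableConstSMul Γ S]
    (D : EquivariantSections Γ Δ σ) {E : Type*} [TopologicalSpace E] (φ : Δ × Δ → E) (g h : Γ) :
    StronglyMeasurable fun s => φ (D.θ (g • s), D.θ (h • s)) := by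
  refine stronglyMeasurable_comp_of_countable (T := fun s => (D.θ (g • s), D.θ (h • s)))
    (fun i => ?_) φ
  have : (fun s => (D.θ (g • s), D.θ (h • s))) ⁻¹' {i} =
      (fun s => g • s) ⁻¹' (D.θ ⁻¹' {i.1}) ∩ (fun s => h • s) ⁻¹' (D.θ ⁻¹' {i.2}) := by
    ext s; simp [Prod.ext_iff]
  rw [this]
  exact (measurable_const_smul g (D.measurable_θ _)).inter
    (measurable_const_smul h (D.measurable_θ _))

theorem Weight.measurable_smul [MeasurableConstSMul Γ S]
    {D : EquivariantSections Γ Δ σ} (W : D.Weight) (γ : Γ) :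
    Measurable fun s => W.F (γ • s) := W.measurable.comp (measurable_const_smul γ)

theorem Weight.eq_zero_smul {D : EquivariantSections Γ Δ σ} (W : D.Weight) (γ : Γ) {s : S}
    (hs : s ∈ D.N) : W.F (γ • s) = 0 := by
  by_contra h
  exact D.notMem_of_smul γ (fun h' => h (W.eq_zero _ h')) hs

theorem stronglyMeasurable_kernel [Countable Δ] [MeasurableConstSMul Γ S]
    (D : EquivariantSections Γ Δ σ) (W : D.Weight) (u : Δ → ℂ) (g h : Γ) : StronglyMeasurable fun s =>
      ((W.F (g • s) * W.F (h • s) : ℝ) : ℂ) * u ((D.θ (h • s))⁻¹ * D.θ (g • s)) :=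
  ((Complex.measurable_ofReal.comp
    ((W.measurable_smul g).mul (W.measurable_smul h))).stronglyMeasurable).mul
    (D.stronglyMeasurable_θ_pair (fun p => u (p.2⁻¹ * p.1)) g h)

variable [SMulCommClass Γ Δ S]

theorem Weight.left_right_smul {D : EquivariantSections Γ Δ σ} (W : D.Weight) (γ : Γ) (δ : Δ)
    (s : S) : W.F (γ • δ • s) = W.F (γ • s) := by
  rw [smul_comm, W.right_smul]

theorem θ_left_right_smul (D : EquivariantSections Γ Δ σ) (γ : Γ) (δ : Δ) {s : S} (hs : s ∉ D.N) :
    D.θ (γ • δ • s) = δ * D.θ (γ • s) := by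
  rw [smul_comm, D.θ_smul _ _ (D.left_notMem _ _ hs)]

/-- Off `D.N` both values of `θ` acquire the factor `δ`, which cancels; on `D.N` the weights vanish.
The identity therefore holds at every point, as `integral_smul` requires. -/
theorem kernel_right_smul (D : EquivariantSections Γ Δ σ) (W : D.Weight) {E : Type*}
    [NormedAddCommGroup E] [NormedSpace ℂ E] (u : Δ → E) (g h : Γ)
    (δ : Δ) (s : S) :
    ((W.F (g • δ • s) * W.F (h • δ • s) : ℝ) : ℂ) •
        u ((D.θ (h • δ • s))⁻¹ * D.θ (g • δ • s)) =
      ((W.F (g • s) * W.F (h • s) : ℝ) : ℂ) • u ((D.θ (h • s))⁻¹ * D.θ (g • s)) := by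
  rw [W.left_right_smul, W.left_right_smul]
  by_cases hs : s ∈ D.N
  · simp [W.eq_zero_smul _ hs]
  · rw [D.θ_left_right_smul _ _ hs, D.θ_left_right_smul _ _ hs]
    simp

variable [Countable Δ] [MeasurableConstSMul Γ S]

variable [MeasurableConstSMul Δ S] [SMulInvariantMeasure Γ S σ] [SMulInvariantMeasure Δ S σ]

theorem Weight.integral_smul_sq {D : EquivariantSections Γ Δ σ} (W : D.Weight) (γ : Γ) :
    ∫ s in D.domain, W.F (γ • s) ^ 2 ∂σ = ∫ s in D.domain, W.F s ^ 2 ∂σ :=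
  D.integral_smul (f := fun s => W.F s ^ 2) (fun δ s => by rw [W.right_smul]) γ

theorem Weight.integrableOn_smul_sq {D : EquivariantSections Γ Δ σ} (W : D.Weight) (γ : Γ) :
    IntegrableOn (fun s => W.F (γ • s) ^ 2) D.domain σ :=
  D.integrableOn_smul (f := fun s => W.F s ^ 2) (fun δ s => by rw [W.right_smul])
    W.integrableOn_sq γ

theorem Weight.integrableOn_mul {D : EquivariantSections Γ Δ σ} (W W' : D.Weight) (g h : Γ) :
    IntegrableOn (fun s => W.F (g • s) * W'.F (h • s)) D.domain σ := by
  refine ((W.integrableOn_smul_sq g).add (W'.integrableOn_smul_sq h)).mono'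
    ((W.measurable_smul g).mul (W'.measurable_smul h)).aestronglyMeasurable
    (Eventually.of_forall fun s => ?_)
  rw [Real.norm_of_nonneg (mul_nonneg (W.nonneg _) (W'.nonneg _))]
  simp only [Pi.add_apply]
  nlinarith [sq_nonneg (W.F (g • s) - W'.F (h • s)), sq_nonneg (W.F (g • s)),
    sq_nonneg (W'.F (h • s))]

theorem Weight.integral_mul_le {D : EquivariantSections Γ Δ σ} (W : D.Weight) (g h : Γ) :
    ∫ s in D.domain, W.F (g • s) * W.F (h • s) ∂σ ≤ 1 := by
  have h1 : ∫ s in D.domain, W.F (g • s) * W.F (h • s) ∂σ ≤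
      ∫ s in D.domain, (W.F (g • s) ^ 2 + W.F (h • s) ^ 2) / 2 ∂σ := by
    refine integral_mono (W.integrableOn_mul W g h)
      (((W.integrableOn_smul_sq g).add (W.integrableOn_smul_sq h)).div_const 2) fun s => ?_
    simp only
    nlinarith [sq_nonneg (W.F (g • s) - W.F (h • s))]
  rw [integral_div, integral_add (W.integrableOn_smul_sq g) (W.integrableOn_smul_sq h),
    W.integral_smul_sq, W.integral_smul_sq] at h1
  linarith [W.integral_sq_le]

theorem integrableOn_kernel (D : EquivariantSections Γ Δ σ) (W : D.Weight) {u : Δ → ℂ} {M : ℝ}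
    (hu : ∀ δ, ‖u δ‖ ≤ M) (g h : Γ) : IntegrableOn (fun s =>
      ((W.F (g • s) * W.F (h • s) : ℝ) : ℂ) * u ((D.θ (h • s))⁻¹ * D.θ (g • s))) D.domain σ := by
  refine ((W.integrableOn_mul W g h).mul_const M).mono'
    (D.stronglyMeasurable_kernel W u g h).aestronglyMeasurable (Eventually.of_forall fun s => ?_)
  rw [norm_mul, Complex.norm_real, Real.norm_of_nonneg (mul_nonneg (W.nonneg _) (W.nonneg _))]
  exact mul_le_mul_of_nonneg_left (hu _) (mul_nonneg (W.nonneg _) (W.nonneg _))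

/-- The kernel attached to the induced function. -/
theorem transfer_inv_mul (D : EquivariantSections Γ Δ σ) (W : D.Weight) (u : Δ → ℂ) (g h : Γ) :
    D.transfer W u (h⁻¹ * g) = ∫ x in D.domain,
      ((W.F (g⁻¹ • x) * W.F (h⁻¹ • x) : ℝ) : ℂ) * u ((D.θ (h⁻¹ • x))⁻¹ * D.θ (g⁻¹ • x)) ∂σ := by
  rw [← D.integral_smul (fun δ s => D.kernel_right_smul W u g⁻¹ h⁻¹ δ s) h]
  simp [transfer, smul_smul]

theorem norm_transfer_le (D : EquivariantSections Γ Δ σ) (W : D.Weight) {u : Δ → ℂ} {M : ℝ}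
    (hu : ∀ δ, ‖u δ‖ ≤ M) (γ : Γ) : ‖D.transfer W u γ‖ ≤ M := by
  have hM : 0 ≤ M := (norm_nonneg _).trans (hu 1)
  have h1 := norm_integral_le_of_norm_le (μ := σ.restrict D.domain)
    ((W.integrableOn_mul W γ⁻¹ 1).mul_const M)
    (f := fun x => ((W.F (γ⁻¹ • x) * W.F x : ℝ) : ℂ) * u ((D.θ x)⁻¹ * D.θ (γ⁻¹ • x)))
    (Eventually.of_forall fun s => by
      rw [norm_mul, Complex.norm_real,
        Real.norm_of_nonneg (mul_nonneg (W.nonneg _) (W.nonneg _)), one_smul]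
      exact mul_le_mul_of_nonneg_left (hu _) (mul_nonneg (W.nonneg _) (W.nonneg _)))
  refine h1.trans ?_
  rw [integral_mul_const]
  nlinarith [W.integral_mul_le γ⁻¹ 1]

theorem integrableOn_transfer (D : EquivariantSections Γ Δ σ) (W : D.Weight) {u : Δ → ℂ} {M : ℝ}
    (hu : ∀ δ, ‖u δ‖ ≤ M) (γ : Γ) : IntegrableOn (fun x =>
      ((W.F (γ⁻¹ • x) * W.F x : ℝ) : ℂ) * u ((D.θ x)⁻¹ * D.θ (γ⁻¹ • x))) D.domain σ := by
  simpa using D.integrableOn_kernel W hu γ⁻¹ 1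

theorem transfer_add (D : EquivariantSections Γ Δ σ) (W : D.Weight) {u v : Δ → ℂ} {M M' : ℝ}
    (hu : ∀ δ, ‖u δ‖ ≤ M) (hv : ∀ δ, ‖v δ‖ ≤ M') (γ : Γ) :
    D.transfer W (u + v) γ = D.transfer W u γ + D.transfer W v γ := by
  rw [transfer, transfer, transfer,
    ← integral_add (D.integrableOn_transfer W hu γ) (D.integrableOn_transfer W hv γ)]
  simp [mul_add]

/-- These are the vectors of the induced factorization through `L²(X, H)`, used with `g⁻¹` in place
of `g`. -/
theorem memLp_vector (D : EquivariantSections Γ Δ σ) (W : D.Weight) {H : Type*}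
    [NormedAddCommGroup H] [InnerProductSpace ℂ H] {ξ : Δ → H} {a : ℝ} (hξ : ∀ δ, ‖ξ δ‖ ≤ a)
    (g : Γ) : MemLp (fun s => ((W.F (g • s) : ℝ) : ℂ) • ξ (D.θ (g • s))) 2
      (σ.restrict D.domain) := by
  have h1 : MemLp (fun s => W.F (g • s)) 2 (σ.restrict D.domain) :=
    (memLp_two_iff_integrable_sq (W.measurable_smul g).aestronglyMeasurable).2
      (W.integrableOn_smul_sq g)
  refine h1.of_le_mul (c := a) ?_ (Eventually.of_forall fun s => ?_)
  · exact (((Complex.measurable_ofReal.comp (W.measurable_smul g)).stronglyMeasurable).smul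
      (D.stronglyMeasurable_θ_pair (fun p => ξ p.1) g g)).aestronglyMeasurable
  · rw [norm_smul, Complex.norm_real, mul_comm]
    exact mul_le_mul_of_nonneg_right (hξ _) (norm_nonneg _)

/-- Inducing does not increase the Herz-Schur norm. -/
theorem isHerzSchur_transfer [Countable Γ] (D : EquivariantSections Γ Δ σ) (W : D.Weight)
    {u : Δ → ℂ} (hu : IsHerzSchur u) {C : ℝ} (hC : herzSchurNorm u < C) (hC0 : 0 ≤ C) :
    IsHerzSchur (D.transfer W u) ∧ herzSchurNorm (D.transfer W u) ≤ C := by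
  obtain ⟨H, _, _, _, _, ξ, η, hξ, hη, h⟩ := hu.exists_factorization hC
  have hin : ∀ {ξ η : Δ → H} (hξ : ∀ g, ‖ξ g‖ ≤ √C) (hη : ∀ g, ‖η g‖ ≤ √C) (g k : Γ),
      inner ℂ ((D.memLp_vector W hη k).toLp _) ((D.memLp_vector W hξ g).toLp _) =
      ∫ x in D.domain, ((W.F (g • x) * W.F (k • x) : ℝ) : ℂ) *
        inner ℂ (η (D.θ (k • x))) (ξ (D.θ (g • x))) ∂σ := by
    intro ξ η hξ hη g k
    rw [L2.inner_def]
    refine integral_congr_ae ?_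
    filter_upwards [(D.memLp_vector W hη k).coeFn_toLp, (D.memLp_vector W hξ g).coeFn_toLp]
      with x h1 h2
    rw [h1, h2, inner_smul_left, inner_smul_right, Complex.conj_ofReal]
    push_cast
    ring
  have hnorm : ∀ {ξ : Δ → H} (hξ : ∀ g, ‖ξ g‖ ≤ √C) (g : Γ),
      ‖(D.memLp_vector W hξ g).toLp _‖ ≤ √C := by
    intro ξ hξ g
    have h1 := hin hξ hξ g g
    rw [inner_self_eq_norm_sq_to_K] at h1
    refine Real.le_sqrt_of_sq_le ?_
    have h2 : ‖(D.memLp_vector W hξ g).toLp _‖ ^ 2 =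
        ∫ x in D.domain, W.F (g • x) ^ 2 * ‖ξ (D.θ (g • x))‖ ^ 2 ∂σ := by
      have h3 : ∀ x, ((W.F (g • x) * W.F (g • x) : ℝ) : ℂ) *
          inner ℂ (ξ (D.θ (g • x))) (ξ (D.θ (g • x))) =
          ((W.F (g • x) ^ 2 * ‖ξ (D.θ (g • x))‖ ^ 2 : ℝ) : ℂ) := fun x => by
        rw [inner_self_eq_norm_sq_to_K]
        push_cast
        simp [pow_two]
      simp only [h3] at h1
      rw [integral_complex_ofReal] at h1
      exact Complex.ofReal_injective ((Complex.ofReal_pow _ 2).trans h1)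
    rw [h2]
    have h4 : ∫ x in D.domain, W.F (g • x) ^ 2 * ‖ξ (D.θ (g • x))‖ ^ 2 ∂σ ≤
        ∫ x in D.domain, W.F (g • x) ^ 2 * C ∂σ := by
      refine integral_mono_of_nonneg (Eventually.of_forall fun x => by positivity)
        ((W.integrableOn_smul_sq g).mul_const C) (Eventually.of_forall fun x => ?_)
      refine mul_le_mul_of_nonneg_left ?_ (sq_nonneg _)
      calc ‖ξ (D.θ (g • x))‖ ^ 2 ≤ √C ^ 2 := by gcongr; exact hξ _
        _ = C := Real.sq_sqrt hC0
    refine h4.trans ?_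
    rw [integral_mul_const, W.integral_smul_sq]
    nlinarith [W.integral_sq_le]
  have := herzSchurNorm_le_of_factorization (u := D.transfer W u)
    (fun g : Γ => (D.memLp_vector W hξ g⁻¹).toLp _) (fun g : Γ => (D.memLp_vector W hη g⁻¹).toLp _)
    (fun g => hnorm hξ g⁻¹) (fun g => hnorm hη g⁻¹) (fun g k => by
      rw [D.transfer_inv_mul, hin hξ hη]
      simp only [h])
  rwa [Real.mul_self_sqrt hC0] at this

/-- Coefficients sitting at the same group element are added up. Repetitions must be allowed because
`g ↦ θ(g⁻¹x)` need not be injective. -/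
theorem _root_.IsPositiveDefiniteFun.sum_nonneg {G ι : Type*} [Group G] {u : G → ℂ}
    (hu : IsPositiveDefiniteFun u) (s : Finset ι) (a : ι → G) (c : ι → ℂ) :
    0 ≤ ∑ i ∈ s, ∑ j ∈ s, (starRingEnd ℂ) (c i) * c j * u ((a i)⁻¹ * a j) := by
  classical
  have h := hu (s.image a) fun g => ∑ i ∈ s with a i = g, c i
  refine h.trans_eq ?_
  rw [← Finset.sum_fiberwise_of_maps_to (g := a) (t := s.image a)
    (fun i hi => Finset.mem_image_of_mem a hi)]
  refine Finset.sum_congr rfl fun g _ => ?_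
  rw [Finset.sum_comm]
  rw [← Finset.sum_fiberwise_of_maps_to (g := a) (t := s.image a)
    (fun i hi => Finset.mem_image_of_mem a hi)]
  refine Finset.sum_congr rfl fun k _ => ?_
  rw [map_sum, Finset.sum_mul_sum, Finset.sum_mul, Finset.sum_comm]
  refine Finset.sum_congr rfl fun i hi => ?_
  rw [Finset.sum_mul]
  refine Finset.sum_congr rfl fun j hj => ?_
  rw [(Finset.mem_filter.1 hi).2, (Finset.mem_filter.1 hj).2]

/-- Inducing preserves positive definiteness. -/
theorem isPositiveDefiniteFun_transfer (D : EquivariantSections Γ Δ σ) (W : D.Weight)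
    {u : Δ → ℂ} (hu : IsPositiveDefiniteFun u) {M : ℝ} (hM : ∀ δ, ‖u δ‖ ≤ M) :
    IsPositiveDefiniteFun (D.transfer W u) := by
  intro s c
  have hi : ∀ g h : Γ, IntegrableOn (fun x => (starRingEnd ℂ) (c g) * c h *
      (((W.F (h⁻¹ • x) * W.F (g⁻¹ • x) : ℝ) : ℂ) * u ((D.θ (g⁻¹ • x))⁻¹ * D.θ (h⁻¹ • x))))
      D.domain σ := fun g h => (D.integrableOn_kernel W hM h⁻¹ g⁻¹).const_mul _
  have e : ∑ g ∈ s, ∑ h ∈ s, (starRingEnd ℂ) (c g) * c h * D.transfer W u (g⁻¹ * h) =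
      ∫ x in D.domain, ∑ g ∈ s, ∑ h ∈ s, (starRingEnd ℂ) (c g) * c h *
      (((W.F (h⁻¹ • x) * W.F (g⁻¹ • x) : ℝ) : ℂ) *
        u ((D.θ (g⁻¹ • x))⁻¹ * D.θ (h⁻¹ • x))) ∂σ := by
    rw [integral_finsetSum _ fun g _ => integrable_finsetSum _ fun h _ => hi g h]
    refine Finset.sum_congr rfl fun g _ => ?_
    rw [integral_finsetSum _ fun h _ => hi g h]
    refine Finset.sum_congr rfl fun h _ => ?_
    rw [integral_const_mul, D.transfer_inv_mul]
  rw [e]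
  -- For fixed `x` the integrand is the quadratic form of `u` at the points `θ(g⁻¹x)` with
  -- coefficients `c g * F(g⁻¹x)`.
  refine integral_nonneg fun x => ?_
  refine (hu.sum_nonneg s (fun g => D.θ (g⁻¹ • x))
    (fun g => c g * (W.F (g⁻¹ • x) : ℂ))).trans_eq ?_
  refine Finset.sum_congr rfl fun g _ => Finset.sum_congr rfl fun h _ => ?_
  rw [map_mul, Complex.conj_ofReal]
  push_cast
  ring

end EquivariantSections

/-! ### Cutting down weights, and decay of induced functions -/

namespace EquivariantSections

variable {Γ Δ S : Type*} [Group Γ] [Group Δ] [MeasurableSpace S] [MulAction Γ S] [MulAction Δ S]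
  {σ : Measure S}

/-- The points `s` for which the finitely many points `e θ(s)⁻¹ s`, `e ∈ E`, have their `Γ`-position
in `L`. -/
def boundedPart (D : EquivariantSections Γ Δ σ) (E : Finset Δ) (L : Finset Γ) : Set S :=
  {s | ∀ e ∈ E, D.κ ((e * (D.θ s)⁻¹) • s) ∈ L}

theorem measurableSet_boundedPart [Countable Δ] [MeasurableConstSMul Δ S]
    (D : EquivariantSections Γ Δ σ) (E : Finset Δ) (L : Finset Γ) :
    MeasurableSet (D.boundedPart E L) := by
  have : D.boundedPart E L = ⋂ e ∈ E, ⋃ δ : Δ, D.θ ⁻¹' {δ} ∩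
      (fun s => (e * δ⁻¹) • s) ⁻¹' (⋃ γ ∈ L, D.κ ⁻¹' {γ}) := by
    ext s
    simp [boundedPart]
  rw [this]
  exact Finset.measurableSet_biInter _ fun e _ => MeasurableSet.iUnion fun δ =>
    (D.measurable_θ δ).inter (measurable_const_smul _
      (Finset.measurableSet_biUnion _ fun γ _ => D.measurable_κ γ))

/-- The point `θ(s)⁻¹ s` depends only on the `Δ`-orbit of `s`, so cutting a weight to the bounded
part keeps it `Δ`-invariant. -/
theorem smul_mem_boundedPart_iff (D : EquivariantSections Γ Δ σ) (E : Finset Δ) (L : Finset Γ)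
    (δ : Δ) {s : S} (hs : s ∉ D.N) : δ • s ∈ D.boundedPart E L ↔ s ∈ D.boundedPart E L := by
  simp only [boundedPart, Set.mem_ofPred_eq, D.θ_smul δ s hs, smul_smul, mul_inv_rev, mul_assoc,
    inv_mul_cancel, mul_one]

/-- The restriction of a weight to the bounded part. -/
noncomputable def Weight.restrict [Countable Δ] [MeasurableConstSMul Δ S]
    {D : EquivariantSections Γ Δ σ} (W : D.Weight) (E : Finset Δ) (L : Finset Γ) : D.Weight where
  F := (D.boundedPart E L).indicator W.F
  measurable := W.measurable.indicator (D.measurableSet_boundedPart E L)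
  nonneg := Set.indicator_nonneg fun s _ => W.nonneg s
  right_smul δ s := by
    by_cases hs : s ∈ D.N
    · have h1 : W.F s = 0 := W.eq_zero s hs
      have h2 : W.F (δ • s) = 0 := by rw [W.right_smul, h1]
      rw [Set.indicator_apply_eq_zero.2 fun _ => h1, Set.indicator_apply_eq_zero.2 fun _ => h2]
    · have h := D.smul_mem_boundedPart_iff E L δ hs
      by_cases hB : s ∈ D.boundedPart E L
      · rw [Set.indicator_of_mem hB, Set.indicator_of_mem (h.2 hB), W.right_smul]
      · rw [Set.indicator_of_notMem hB, Set.indicator_of_notMem (mt h.1 hB)]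
  eq_zero s hs := Set.indicator_apply_eq_zero.2 fun _ => W.eq_zero s hs
  integrableOn_sq := by
    refine (W.integrableOn_sq.indicator (D.measurableSet_boundedPart E L)).congr
      (Eventually.of_forall fun s => ?_)
    by_cases hs : s ∈ D.boundedPart E L <;> simp [hs]
  integral_sq_le := by
    refine (integral_mono_of_nonneg (Eventually.of_forall fun s => sq_nonneg _)
      W.integrableOn_sq (Eventually.of_forall fun s => ?_)).trans W.integral_sq_le
    by_cases hs : s ∈ D.boundedPart E L <;> simp [hs, sq_nonneg]

theorem Weight.restrict_le [Countable Δ] [MeasurableConstSMul Δ S]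
    {D : EquivariantSections Γ Δ σ} (W : D.Weight) (E : Finset Δ) (L : Finset Γ) (s : S) :
    (W.restrict E L).F s ≤ W.F s :=
  Set.indicator_le_self' (fun _ _ => W.nonneg _) s

/-- For each `s` only finitely many positions occur, so `s` lies in the bounded part once `L` is
large. Dominated convergence applies along the finite subsets of the countable group `Γ`. -/
theorem exists_integral_sub_restrict_lt [Countable Γ] [Countable Δ]
    [MeasurableConstSMul Δ S] (D : EquivariantSections Γ Δ σ) (W : D.Weight) (E : Finset Δ)
    {ε : ℝ} (hε : 0 < ε) : ∃ L : Finset Γ,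
      ∫ s in D.domain, (W.F s - (W.restrict E L).F s) ^ 2 ∂σ < ε := by
  classical
  have h : Tendsto (fun L : Finset Γ => ∫ s in D.domain, (W.F s - (W.restrict E L).F s) ^ 2 ∂σ)
      atTop (𝓝 (∫ _ in D.domain, (0 : ℝ) ∂σ)) := by
    refine tendsto_integral_filter_of_dominated_convergence (fun s => W.F s ^ 2)
      (Eventually.of_forall fun L =>
        ((W.measurable.sub (W.restrict E L).measurable).pow_const 2).aestronglyMeasurable)
      (Eventually.of_forall fun L => Eventually.of_forall fun s => ?_) W.integrableOn_sq
      (Eventually.of_forall fun s => ?_)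
    · rw [Real.norm_of_nonneg (sq_nonneg _)]
      have := W.restrict_le E L s
      have := (W.restrict E L).nonneg s
      nlinarith
    · refine tendsto_const_nhds.congr' ?_
      filter_upwards [eventually_ge_atTop (E.image fun e => D.κ ((e * (D.θ s)⁻¹) • s))] with L hL
      have : s ∈ D.boundedPart E L := fun e he => hL (Finset.mem_image_of_mem _ he)
      simp [Weight.restrict, this]
  rw [integral_zero] at h
  exact (h.eventually (gt_mem_nhds hε)).exists

variable [SMulCommClass Γ Δ S]

/-- Inducing a finitely supported function with a restricted weight gives a finitely supported
function. -/
theorem finite_support_transfer_restrict [Countable Δ] [MeasurableConstSMul Δ S]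
    (D : EquivariantSections Γ Δ σ) (W : D.Weight) {E : Finset Δ} (h1E : 1 ∈ E) (L : Finset Γ)
    {u : Δ → ℂ} (hu : ∀ δ, δ ∉ E → u δ = 0) :
    (Function.support (D.transfer (W.restrict E L) u)).Finite := by
  classical
  refine (Finset.finite_toSet (Finset.image₂ (fun a b => a * b⁻¹) L L)).subset fun γ hγ => ?_
  by_contra hn
  refine hγ (integral_eq_zero_of_ae (Eventually.of_forall fun x => ?_))
  by_contra hx
  simp only [Pi.zero_apply] at hx
  obtain ⟨hF, hux⟩ := mul_ne_zero_iff.1 hx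
  obtain ⟨hF1, hF2⟩ := mul_ne_zero_iff.1 (Complex.ofReal_ne_zero.1 hF)
  have hxB : x ∈ D.boundedPart E L := Set.mem_of_indicator_ne_zero hF2
  have hyB : γ⁻¹ • x ∈ D.boundedPart E L := Set.mem_of_indicator_ne_zero hF1
  have hxN : x ∉ D.N := fun h => hF2 ((W.restrict E L).eq_zero x h)
  have he : (D.θ x)⁻¹ * D.θ (γ⁻¹ • x) ∈ E := by
    by_contra h
    exact hux (hu _ h)
  -- With `y = γ⁻¹x` and `e = θ(x)⁻¹θ(y)` one has `e θ(y)⁻¹ y = γ⁻¹ θ(x)⁻¹ x`. So `L` contains both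
  -- `k = κ(θ(x)⁻¹x)` (from `1 ∈ E`) and `γ⁻¹k`, and `γ = k (γ⁻¹k)⁻¹`.
  have h1 := hxB 1 h1E
  have h2 := hyB _ he
  rw [one_mul] at h1
  rw [mul_assoc, mul_inv_cancel, mul_one, ← smul_comm, D.κ_smul _ _ (D.right_notMem _ _ hxN)] at h2
  refine hn ?_
  rw [Finset.mem_coe, Finset.mem_image₂]
  exact ⟨_, h1, _, h2, by group⟩

variable [Countable Δ] [MeasurableConstSMul Γ S] [MeasurableConstSMul Δ S]
  [SMulInvariantMeasure Γ S σ] [SMulInvariantMeasure Δ S σ]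

/-- With `R = F - F'`, the weights differ by `F(γ⁻¹x) R(x) + R(γ⁻¹x) F'(x)`. Each product integrates
to at most `t`, by `ab ≤ (t/2)a² + b²/(2t)` in the role of Cauchy-Schwarz. -/
theorem norm_transfer_sub_restrict_le (D : EquivariantSections Γ Δ σ) (W : D.Weight)
    (E : Finset Δ) (L : Finset Γ) {t : ℝ} (ht : 0 < t)
    (hL : ∫ s in D.domain, (W.F s - (W.restrict E L).F s) ^ 2 ∂σ ≤ t ^ 2) {u : Δ → ℂ} {M : ℝ}
    (hu : ∀ δ, ‖u δ‖ ≤ M) (γ : Γ) :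
    ‖D.transfer W u γ - D.transfer (W.restrict E L) u γ‖ ≤ 2 * t * M := by
  have hM : 0 ≤ M := (norm_nonneg _).trans (hu 1)
  set W' := W.restrict E L with hW'
  let R : S → ℝ := fun s => W.F s - W'.F s
  have hRm : Measurable R := W.measurable.sub W'.measurable
  have hRinv : ∀ (δ : Δ) s, R (δ • s) = R s := fun δ s => by
    simp only [R, W.right_smul, W'.right_smul]
  have hR0 : ∀ s, 0 ≤ R s := fun s => sub_nonneg.2 (W.restrict_le E L s)
  have hRi : IntegrableOn (fun s => R s ^ 2) D.domain σ := by
    refine Integrable.mono' W.integrableOn_sq (hRm.pow_const 2).aestronglyMeasurable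
      (Eventually.of_forall fun s => ?_)
    rw [Real.norm_of_nonneg (sq_nonneg _)]
    have := hR0 s
    have := W'.nonneg s
    simp only [R] at *
    nlinarith
  have hRi' : IntegrableOn (fun s => R (γ⁻¹ • s) ^ 2) D.domain σ :=
    D.integrableOn_smul (f := fun s => R s ^ 2) (fun δ s => by rw [hRinv]) hRi γ⁻¹
  have hRint : ∫ s in D.domain, R (γ⁻¹ • s) ^ 2 ∂σ = ∫ s in D.domain, R s ^ 2 ∂σ :=
    D.integral_smul (f := fun s => R s ^ 2) (fun δ s => by rw [hRinv]) γ⁻¹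
  have hFi' := W.integrableOn_smul_sq γ⁻¹
  have a1 : IntegrableOn (fun s => t / 2 * W.F (γ⁻¹ • s) ^ 2) D.domain σ := hFi'.const_mul _
  have a2 : IntegrableOn (fun s => 1 / (2 * t) * R s ^ 2) D.domain σ := hRi.const_mul _
  have a3 : IntegrableOn (fun s => t / 2 * W.F s ^ 2) D.domain σ := W.integrableOn_sq.const_mul _
  have a4 : IntegrableOn (fun s => 1 / (2 * t) * R (γ⁻¹ • s) ^ 2) D.domain σ := hRi'.const_mul _
  have a12 : IntegrableOn (fun s => t / 2 * W.F (γ⁻¹ • s) ^ 2 + 1 / (2 * t) * R s ^ 2)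
      D.domain σ := a1.add a2
  have a34 : IntegrableOn (fun s => t / 2 * W.F s ^ 2 + 1 / (2 * t) * R (γ⁻¹ • s) ^ 2)
      D.domain σ := a3.add a4
  have hbi : IntegrableOn (fun s => (t / 2 * W.F (γ⁻¹ • s) ^ 2 + 1 / (2 * t) * R s ^ 2 +
      (t / 2 * W.F s ^ 2 + 1 / (2 * t) * R (γ⁻¹ • s) ^ 2)) * M) D.domain σ :=
    (a12.add a34).mul_const M
  rw [transfer, transfer, ← integral_sub (D.integrableOn_transfer W hu γ)
    (D.integrableOn_transfer W' hu γ)]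
  refine (norm_integral_le_of_norm_le hbi (Eventually.of_forall fun s => ?_)).trans ?_
  · rw [← sub_mul, norm_mul, ← Complex.ofReal_sub, Complex.norm_real]
    refine mul_le_mul ?_ (hu _) (norm_nonneg _) (by positivity)
    have key : ∀ a b : ℝ, a * b ≤ t / 2 * a ^ 2 + 1 / (2 * t) * b ^ 2 := fun a b => by
      have h : t / 2 * a ^ 2 + 1 / (2 * t) * b ^ 2 - a * b = 1 / (2 * t) * (t * a - b) ^ 2 := by
        field_simp; ring
      have : 0 ≤ 1 / (2 * t) * (t * a - b) ^ 2 := by positivity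
      linarith
    have k1 := key (W.F (γ⁻¹ • s)) (R s)
    have k2 := key (W.F s) (R (γ⁻¹ • s))
    have p1 := hR0 s
    have p2 := hR0 (γ⁻¹ • s)
    have p3 := W'.nonneg s
    have p4 := W'.nonneg (γ⁻¹ • s)
    have p5 := W.nonneg s
    have e : W.F (γ⁻¹ • s) * W.F s - W'.F (γ⁻¹ • s) * W'.F s =
        W.F (γ⁻¹ • s) * R s + R (γ⁻¹ • s) * W'.F s := by simp only [R]; ring
    have e2 : W'.F s ≤ W.F s := sub_nonneg.1 p1
    rw [e, Real.norm_of_nonneg (add_nonneg (mul_nonneg (W.nonneg _) p1) (mul_nonneg p2 p3))]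
    have := mul_le_mul_of_nonneg_left e2 p2
    linarith
  · rw [integral_mul_const, integral_add a12 a34, integral_add a1 a2, integral_add a3 a4]
    simp only [integral_const_mul, W.integral_smul_sq, hRint]
    refine mul_le_mul_of_nonneg_right ?_ hM
    have h1 : 1 / (2 * t) * ∫ s in D.domain, R s ^ 2 ∂σ ≤ t / 2 := by
      calc 1 / (2 * t) * ∫ s in D.domain, R s ^ 2 ∂σ ≤ 1 / (2 * t) * t ^ 2 := by gcongr
        _ = t / 2 := by field_simp
    have h2 : t / 2 * ∫ s in D.domain, W.F s ^ 2 ∂σ ≤ t / 2 * 1 := by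
      gcongr; exact W.integral_sq_le
    linarith

/-- Inducing preserves vanishing at infinity. -/
theorem vanishesAtInfinity_transfer [Countable Γ] (D : EquivariantSections Γ Δ σ)
    (W : D.Weight) {u : Δ → ℂ} (hu0 : VanishesAtInfinity u) {M : ℝ} (hu : ∀ δ, ‖u δ‖ ≤ M) :
    VanishesAtInfinity (D.transfer W u) := by
  classical
  have hM : 0 ≤ M := (norm_nonneg _).trans (hu 1)
  rw [VanishesAtInfinity, Metric.tendsto_nhds]
  intro ε hε
  have hfin : {δ | ¬ dist (u δ) 0 < ε / 4}.Finite := by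
    have := (Metric.tendsto_nhds.1 hu0) (ε / 4) (by positivity)
    exact this
  -- Split `u` into a finitely supported part and a part bounded by `ε/4`; the point `1` is added
  -- for the finite support argument.
  let E : Finset Δ := insert 1 hfin.toFinset
  have hE : ∀ δ, δ ∉ E → ‖u δ‖ ≤ ε / 4 := fun δ hδ => by
    by_contra h
    refine hδ (Finset.mem_insert_of_mem ?_)
    rw [Set.Finite.mem_toFinset]
    simpa [dist_zero_right] using le_of_lt (not_le.1 h)
  let u₁ : Δ → ℂ := (E : Set Δ).indicator u
  let u₂ : Δ → ℂ := (E : Set Δ)ᶜ.indicator u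
  have hu₁ : ∀ δ, ‖u₁ δ‖ ≤ M := fun δ => (norm_indicator_le_norm_self _ _).trans (hu δ)
  have hu₂ : ∀ δ, ‖u₂ δ‖ ≤ ε / 4 := fun δ => by
    by_cases hδ : δ ∈ E
    · simp only [u₂, Set.indicator_apply, Set.mem_compl_iff, Finset.mem_coe, hδ, not_true,
        if_false, norm_zero]
      positivity
    · simpa [u₂, hδ] using hE δ hδ
  have hsum : u = u₁ + u₂ := (Set.indicator_self_add_compl _ _).symm
  have ht : 0 < ε / (8 * (M + 1)) := by positivity
  obtain ⟨L, hL⟩ := D.exists_integral_sub_restrict_lt W E (pow_pos ht 2)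
  have hsupp := D.finite_support_transfer_restrict W (Finset.mem_insert_self 1 _) L (u := u₁)
    (fun δ hδ => Set.indicator_of_notMem (fun h => hδ (Finset.mem_coe.1 h)) _)
  -- Where the cut-down function vanishes, the function induced from `u₁` is just the cutting error,
  -- at most `ε/4` by the choice of `t`.
  refine hsupp.subset fun γ hγ h0 => hγ ?_
  have h1 := D.norm_transfer_sub_restrict_le W E L ht hL.le hu₁ γ
  have h2 := D.norm_transfer_le W hu₂ γ
  have h3 : 2 * (ε / (8 * (M + 1))) * M ≤ ε / 4 := by
    rw [show 2 * (ε / (8 * (M + 1))) * M = ε / 4 * (M / (M + 1)) by field_simp; ring]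
    have : M / (M + 1) ≤ 1 := (div_le_one (by positivity)).2 (by linarith)
    nlinarith
  rw [h0, sub_zero] at h1
  change dist _ _ < ε
  rw [dist_zero_right, hsum, D.transfer_add W hu₁ hu₂]
  refine (norm_add_le _ _).trans_lt ?_
  linarith

/-- `Γ` has almost invariant weights: for all finite `K` and `ε > 0` there is a normalized weight
which is `ε`-invariant under `K`. -/
def HasAlmostInvariantWeights (D : EquivariantSections Γ Δ σ) : Prop :=
  ∀ (K : Finset Γ) (ε : ℝ), 0 < ε → ∃ W : D.Weight, ∫ s in D.domain, W.F s ^ 2 ∂σ = 1 ∧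
    ∀ γ ∈ K, 1 - ε < ∫ s in D.domain, W.F (γ⁻¹ • s) * W.F s ∂σ

/-- The weight is fixed first, from `K` and `ε` alone. For that weight, boundedness and pointwise
convergence of `u n` to `1` give convergence of the induced functions to `∫ F(γ⁻¹x) F(x)`, which is
within `ε/2` of `1`. -/
theorem exists_transfer_near_one {D : EquivariantSections Γ Δ σ}
    (hD : D.HasAlmostInvariantWeights) {u : ℕ → Δ → ℂ} {M : ℝ} (hM : ∀ n δ, ‖u n δ‖ ≤ M)
    (hu : TendsToOneOnCompacts u) (K : Finset Γ) {ε : ℝ} (hε : 0 < ε) :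
    ∃ W : D.Weight, ∫ s in D.domain, W.F s ^ 2 ∂σ = 1 ∧
      ∃ n, ∀ γ ∈ K, ‖D.transfer W (u n) γ - 1‖ < ε := by
  obtain ⟨W, hW1, hW⟩ := hD K (ε / 2) (by positivity)
  refine ⟨W, hW1, ?_⟩
  have hpt : ∀ δ, Tendsto (fun n => u n δ) atTop (𝓝 1) := fun δ =>
    (hu {δ} (Set.finite_singleton δ)).tendsto_at (Set.mem_singleton δ)
  have hlim : ∀ γ, Tendsto (fun n => D.transfer W (u n) γ) atTop
      (𝓝 (((∫ s in D.domain, W.F (γ⁻¹ • s) * W.F s ∂σ : ℝ)) : ℂ)) := by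
    intro γ
    rw [← integral_complex_ofReal]
    have hb := W.integrableOn_mul W γ⁻¹ 1
    simp only [one_smul] at hb
    refine tendsto_integral_of_dominated_convergence (fun s => W.F (γ⁻¹ • s) * W.F s * M)
      (fun n => (D.integrableOn_transfer W (hM n) γ).1) (hb.mul_const M)
      (fun n => Eventually.of_forall fun s => ?_) (Eventually.of_forall fun s => ?_)
    · rw [norm_mul, Complex.norm_real,
        Real.norm_of_nonneg (mul_nonneg (W.nonneg _) (W.nonneg _))]
      exact mul_le_mul_of_nonneg_left (hM n _) (mul_nonneg (W.nonneg _) (W.nonneg _))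
    · simpa using (hpt ((D.θ s)⁻¹ * D.θ (γ⁻¹ • s))).const_mul
        (((W.F (γ⁻¹ • s) * W.F s : ℝ)) : ℂ)
  have hev : ∀ᶠ n in atTop, ∀ γ ∈ K, ‖D.transfer W (u n) γ - 1‖ < ε := by
    rw [eventually_all_finset]
    intro γ hγ
    have h1 := Metric.tendsto_nhds.1 (hlim γ) (ε / 2) (by positivity)
    filter_upwards [h1] with n hn
    have h2 := hW γ hγ
    have h3 := W.integral_mul_le γ⁻¹ 1
    simp only [one_smul] at h3
    rw [dist_eq_norm] at hn
    set I := ∫ s in D.domain, W.F (γ⁻¹ • s) * W.F s ∂σ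
    have h4 : ‖((I : ℂ) - 1)‖ ≤ ε / 2 := by
      rw [← Complex.ofReal_one, ← Complex.ofReal_sub, Complex.norm_real, Real.norm_eq_abs, abs_le]
      constructor <;> linarith
    calc ‖D.transfer W (u n) γ - 1‖ = ‖(D.transfer W (u n) γ - I) + (I - 1)‖ := by ring_nf
      _ ≤ _ := norm_add_le _ _
      _ < ε := by linarith
  exact hev.exists

end EquivariantSections

/-! ### Permanence of the weak forms of amenability -/

/-- The finite subsets of a countable group have a cofinal sequence; pair its `n`th term with
tolerance `1/(n+1)`. -/
theorem exists_seq_tendsToOneOnCompacts {Γ : Type*} [Countable Γ] {P : (Γ → ℂ) → Prop}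
    (h : ∀ (K : Finset Γ) (ε : ℝ), 0 < ε → ∃ v, P v ∧ ∀ γ ∈ K, ‖v γ - 1‖ < ε) :
    ∃ v : ℕ → Γ → ℂ, (∀ n, P (v n)) ∧ TendsToOneOnCompacts v := by
  obtain ⟨K, hK⟩ := exists_seq_tendsto (atTop : Filter (Finset Γ))
  choose v hP hv using fun n : ℕ => h (K n) (1 / (n + 1)) Nat.one_div_pos_of_nat
  refine ⟨v, hP, fun A hA => ?_⟩
  rw [Metric.tendstoUniformlyOn_iff]
  intro ε hε
  obtain ⟨N, hN⟩ := exists_nat_one_div_lt hε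
  filter_upwards [hK.eventually_ge_atTop hA.toFinset, eventually_ge_atTop N] with n h1 h2 γ hγ
  rw [dist_comm, dist_eq_norm]
  refine (hv n γ (h1 (hA.mem_toFinset.2 hγ))).trans (lt_of_le_of_lt ?_ hN)
  exact one_div_le_one_div_of_le (by positivity) (by exact_mod_cast Nat.succ_le_succ h2)

theorem TendsToOneOnCompacts.exists_near_one {Γ : Type*} {u : ℕ → Γ → ℂ}
    (hu : TendsToOneOnCompacts u) (K : Finset Γ) {ε : ℝ} (hε : 0 < ε) :
    ∃ n, ∀ γ ∈ K, ‖u n γ - 1‖ < ε := by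
  obtain ⟨n, hn⟩ := ((Metric.tendstoUniformlyOn_iff.1 (hu K K.finite_toSet)) ε hε).exists
  refine ⟨n, fun γ hγ => ?_⟩
  have := hn γ hγ
  rwa [dist_comm, dist_eq_norm] at this

theorem IsPositiveDefiniteFun.norm_le_one {G : Type*} [Group G] {u : G → ℂ}
    (hu : IsPositiveDefiniteFun u) (h1 : u 1 = 1) (g : G) : ‖u g‖ ≤ 1 := by
  have key : ∀ z : ℂ, 0 ≤ 1 + z * u g + ((starRingEnd ℂ) z * u g⁻¹ + (starRingEnd ℂ) z * z) := by
    intro z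
    simpa [Fin.sum_univ_two, h1] using hu.sum_nonneg (ι := Fin 2) Finset.univ ![1, g] ![1, z]
  have k1 := (Complex.le_def.1 (key 1)).2
  have k2 := (Complex.le_def.1 (key Complex.I)).2
  simp at k1 k2
  have hconj : u g⁻¹ = (starRingEnd ℂ) (u g) := by
    apply Complex.ext
    · simp; linarith
    · simp; linarith
  -- For this `z` the quadratic form equals `1 - |u g|²`.
  have k3 := (Complex.le_def.1 (key (-(starRingEnd ℂ) (u g)))).1
  rw [hconj] at k3
  simp at k3
  have h2 : ‖u g‖ ^ 2 = (u g).re ^ 2 + (u g).im ^ 2 := by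
    rw [Complex.sq_norm, Complex.normSq_apply]; ring
  have h3 : ‖u g‖ ^ 2 ≤ 1 := by rw [h2]; nlinarith
  nlinarith [norm_nonneg (u g)]

/-! ### Passing from `Δ` to `Γ` with almost invariant weights -/

namespace EquivariantSections

variable {Γ Δ S : Type*} [Group Γ] [Group Δ] [MeasurableSpace S] [MulAction Γ S] [MulAction Δ S]
  {σ : Measure S} [SMulCommClass Γ Δ S] [Countable Γ] [Countable Δ] [MeasurableConstSMul Γ S]
  [MeasurableConstSMul Δ S] [SMulInvariantMeasure Γ S σ] [SMulInvariantMeasure Δ S σ]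
  {D : EquivariantSections Γ Δ σ}

theorem HasAlmostInvariantWeights.hasHaagerupProperty (hD : D.HasAlmostInvariantWeights)
    (h : HasHaagerupProperty Δ) : HasHaagerupProperty Γ := by
  obtain ⟨u, hu, hu1⟩ := h
  refine exists_seq_tendsToOneOnCompacts
    (P := fun v : Γ → ℂ => v 1 = 1 ∧ IsPositiveDefiniteFun v ∧ VanishesAtInfinity v) fun K ε hε => ?_
  have hb : ∀ n δ, ‖u n δ‖ ≤ 1 := fun n => (hu n).2.1.norm_le_one (hu n).1
  obtain ⟨W, hW, n, hn⟩ := exists_transfer_near_one hD hb hu1 K hε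
  refine ⟨_, ⟨?_, D.isPositiveDefiniteFun_transfer W (hu n).2.1 (hb n),
    D.vanishesAtInfinity_transfer W (hu n).2.2 (hb n)⟩, hn⟩
  have : ∀ x, ((W.F x * W.F x : ℝ) : ℂ) = ((W.F x ^ 2 : ℝ) : ℂ) := fun x => by rw [pow_two]
  simp only [transfer, inv_one, one_smul, inv_mul_cancel, (hu n).1, mul_one, this]
  rw [integral_complex_ofReal, hW, Complex.ofReal_one]

/-- Inducing requires a strict bound on the norm; the resulting loss of `ε` disappears in the
infimum. -/
theorem HasAlmostInvariantWeights.weakHaagerupConst_le (hD : D.HasAlmostInvariantWeights) :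
    weakHaagerupConst Γ ≤ weakHaagerupConst Δ := by
  refine le_iInf₂ fun C hC => ENNReal.le_of_forall_pos_le_add fun ε hε _ => ?_
  obtain ⟨hC1, u, hu, hu1⟩ := hC
  have hε' : (0 : ℝ) < ε := hε
  rw [← ENNReal.ofReal_coe_nnreal, ← ENNReal.ofReal_add (by linarith) hε'.le]
  refine iInf₂_le (C + ε) ⟨by linarith, ?_⟩
  have hlt : ∀ n, herzSchurNorm (u n) < C + ε := fun n => by linarith [(hu n).2.2]
  refine exists_seq_tendsToOneOnCompacts
    (P := fun v : Γ → ℂ => IsHerzSchur v ∧ VanishesAtInfinity v ∧ herzSchurNorm v ≤ C + ε) fun K η hη => ?_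
  have hb : ∀ n δ, ‖u n δ‖ ≤ C + ε := fun n => (hu n).1.norm_apply_le (hlt n)
  obtain ⟨W, -, n, hn⟩ := exists_transfer_near_one hD hb hu1 K hη
  have := D.isHerzSchur_transfer W (hu n).1 (hlt n) (by linarith)
  exact ⟨_, ⟨this.1, D.vanishesAtInfinity_transfer W (hu n).2.1 (hb n), this.2⟩, hn⟩

theorem _root_.exists_seq_finite_support_of_memFourierAlgebra {G : Type*} [Group G] [Countable G]
    {C C' : ℝ} (hC0 : 0 ≤ C) (hCC' : C < C') {u : ℕ → G → ℂ}
    (hu : ∀ n, MemFourierAlgebra (u n) ∧ IsHerzSchur (u n) ∧ herzSchurNorm (u n) ≤ C)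
    (hu1 : TendsToOneOnCompacts u) :
    ∃ v : ℕ → G → ℂ, (∀ n, (Function.support (v n)).Finite ∧ IsHerzSchur (v n) ∧
      herzSchurNorm (v n) ≤ C') ∧ TendsToOneOnCompacts v := by
  refine exists_seq_tendsToOneOnCompacts
    (P := fun v : G → ℂ => (Function.support v).Finite ∧ IsHerzSchur v ∧ herzSchurNorm v ≤ C') fun K ε hε => ?_
  obtain ⟨n, hn⟩ := hu1.exists_near_one K (half_pos hε)
  obtain ⟨hA, hH, hle⟩ := hu n
  -- One tolerance for two purposes: the Herz-Schur norm stays below `C'`, and, as it dominates the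
  -- sup norm, values on `K` move by less than `ε/2`.
  set η := min (ε / 2) ((C' - C) / 2)
  have hη : 0 < η := lt_min (half_pos hε) (by linarith)
  obtain ⟨v, hv, hvH, hvn⟩ := hA.exists_finite_support (half_pos hη)
  have hvn' : herzSchurNorm (v - u n) < η := by linarith
  have h1 := hH.add hvH (a := C + (C' - C) / 2) (b := η) (by linarith) hvn' (by linarith) hη.le
  rw [add_sub_cancel] at h1
  refine ⟨v, ⟨hv, h1.1, h1.2.trans ?_⟩, fun γ hγ => ?_⟩
  · linarith [min_le_right (ε / 2) ((C' - C) / 2)]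
  · have h2 := hvH.norm_apply_le hvn' γ
    have h3 := hn γ hγ
    calc ‖v γ - 1‖ = ‖(v - u n) γ + (u n γ - 1)‖ := by rw [Pi.sub_apply]; ring_nf
      _ ≤ ‖(v - u n) γ‖ + ‖u n γ - 1‖ := norm_add_le _ _
      _ < ε := by linarith [min_le_left (ε / 2) ((C' - C) / 2)]

/-- Membership in `A(Γ)` is secured through finite support: start from finitely supported functions
on `Δ` and induce with a cut-down weight. The cut does not affect the norm bound and moves values by
at most `η/2`. -/
theorem HasAlmostInvariantWeights.cowlingHaagerupConst_le (hD : D.HasAlmostInvariantWeights) :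
    cowlingHaagerupConst Γ ≤ cowlingHaagerupConst Δ := by
  classical
  refine le_iInf₂ fun C hC => ENNReal.le_of_forall_pos_le_add fun ε hε _ => ?_
  obtain ⟨hC1, u, hu, hu1⟩ := hC
  have hε' : (0 : ℝ) < ε := hε
  rw [← ENNReal.ofReal_coe_nnreal, ← ENNReal.ofReal_add (by linarith) hε'.le]
  refine iInf₂_le (C + ε) ⟨by linarith, ?_⟩
  obtain ⟨v, hv, hv1⟩ := exists_seq_finite_support_of_memFourierAlgebra (C' := C + ε / 2)
    (by linarith) (by linarith) hu hu1
  have hlt : ∀ n, herzSchurNorm (v n) < C + ε := fun n => by linarith [(hv n).2.2]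
  refine exists_seq_tendsToOneOnCompacts
    (P := fun v : Γ → ℂ => MemFourierAlgebra v ∧ IsHerzSchur v ∧ herzSchurNorm v ≤ C + ε) fun K η hη => ?_
  have hb : ∀ n δ, ‖v n δ‖ ≤ C + ε := fun n => (hv n).2.1.norm_apply_le (hlt n)
  obtain ⟨W, -, n, hn⟩ := exists_transfer_near_one hD hb hv1 K (half_pos hη)
  let E : Finset Δ := insert 1 (hv n).1.toFinset
  have ht : 0 < η / (4 * (C + ε)) := by have : 0 < C + ε := by linarith
                                        positivity
  obtain ⟨L, hL⟩ := D.exists_integral_sub_restrict_lt W E (pow_pos ht 2)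
  have h1 := D.isHerzSchur_transfer (W.restrict E L) (hv n).2.1 (hlt n) (by linarith)
  have h2 := D.finite_support_transfer_restrict W (Finset.mem_insert_self 1 _ : 1 ∈ E) L
    (u := v n) fun δ hδ => by
      by_contra h
      exact hδ (Finset.mem_insert_of_mem ((hv n).1.mem_toFinset.2 h))
  refine ⟨_, ⟨memFourierAlgebra_of_finite_support h2, h1⟩, fun γ hγ => ?_⟩
  have h3 := D.norm_transfer_sub_restrict_le W E L ht hL.le (hb n) γ
  have h4 : 2 * (η / (4 * (C + ε))) * (C + ε) = η / 2 := by
    have : C + ε ≠ 0 := by linarith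
    field_simp; ring
  rw [h4] at h3
  calc ‖D.transfer (W.restrict E L) (v n) γ - 1‖ =
      ‖(D.transfer W (v n) γ - 1) -
        (D.transfer W (v n) γ - D.transfer (W.restrict E L) (v n) γ)‖ := by ring_nf
    _ ≤ _ := norm_sub_le _ _
    _ < η := by linarith [hn γ hγ]

end EquivariantSections

/-! ### The orbit space -/

theorem measurable_orbitMk {Δ S : Type*} [Group Δ] [MeasurableSpace S] [MulAction Δ S] :
    Measurable (Quotient.mk (MulAction.orbitRel Δ S)) :=
  measurable_quotient_mk''

section OrbitSpace

variable {Γ Δ S : Type*} [Group Γ] [Group Δ] [MeasurableSpace S] [MulAction Γ S] [MulAction Δ S]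
  [SMulCommClass Γ Δ S] {σ : Measure S}

theorem measurableConstSMul_orbitSpace [MeasurableConstSMul Γ S] :
    MeasurableConstSMul Γ (MulAction.orbitRel.Quotient Δ S) where
  measurable_const_smul γ := by
    refine measurable_from_quotient.2 ?_
    exact measurable_orbitMk.comp (measurable_const_smul γ)

theorem smulInvariantMeasure_orbitSpaceMeasure [Countable Δ] [MeasurableConstSMul Γ S]
    [MeasurableConstSMul Δ S] [SMulInvariantMeasure Γ S σ] [SMulInvariantMeasure Δ S σ]
    {X : Set S} (hX : IsFundamentalDomain Δ X σ) :
    SMulInvariantMeasure Γ (MulAction.orbitRel.Quotient Δ S) (orbitSpaceMeasure Δ σ X) where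
  measure_preimage_smul γ A hA := by
    have hm : Measurable (Quotient.mk (MulAction.orbitRel Δ S)) := measurable_orbitMk
    have hA' : MeasurableSet ((fun q : MulAction.orbitRel.Quotient Δ S => γ • q) ⁻¹' A) :=
      (measurableConstSMul_orbitSpace (Γ := Γ)).measurable_const_smul γ hA
    have hX' : IsFundamentalDomain Δ ((fun s : S => γ⁻¹ • s) ⁻¹' X) σ :=
      hX.preimage_of_equiv (f := fun s : S => γ⁻¹ • s)
        (measurePreserving_smul γ⁻¹ σ).quasiMeasurePreserving (e := id) Function.bijective_id
        (fun δ s => smul_comm _ _ _)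
    set B : Set S := Quotient.mk (MulAction.orbitRel Δ S) ⁻¹' A with hB
    have hBm : MeasurableSet B := hm hA
    rw [orbitSpaceMeasure, Measure.map_apply hm hA', Measure.map_apply hm hA,
      Measure.restrict_apply (hm hA'), Measure.restrict_apply hBm]
    have e : (Quotient.mk (MulAction.orbitRel Δ S) ⁻¹'
        ((fun q : MulAction.orbitRel.Quotient Δ S => γ • q) ⁻¹' A)) ∩ X =
        (fun s : S => γ • s) ⁻¹' (B ∩ (fun s : S => γ⁻¹ • s) ⁻¹' X) := by
      ext s
      simp only [Set.mem_inter_iff, Set.mem_preimage, inv_smul_smul, hB]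
      exact Iff.rfl
    rw [e, (measurePreserving_smul γ σ).measure_preimage
      (hBm.nullMeasurableSet.inter hX'.nullMeasurableSet)]
    refine hX'.measure_set_eq hX hBm fun δ => ?_
    ext s
    have : Quotient.mk (MulAction.orbitRel Δ S) (δ • s) = Quotient.mk (MulAction.orbitRel Δ S) s :=
      Quotient.sound ⟨δ, rfl⟩
    simp only [hB, Set.mem_preimage, this]

namespace EquivariantSections

-- The map `s ↦ θ(s)⁻¹ s`, made constant on `D.N`, descends to the orbit space and pushes its
-- measure to the restriction of `σ` to the domain. A measure with a σ-finite image is σ-finite.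
omit [SMulCommClass Γ Δ S] in
theorem sigmaFinite_orbitSpaceMeasure [Countable Δ] [MeasurableConstSMul Δ S] [SigmaFinite σ]
    (D : EquivariantSections Γ Δ σ) {X : Set S} (hXD : X =ᵐ[σ] D.domain) :
    SigmaFinite (orbitSpaceMeasure Δ σ X) := by
  classical
  rcases isEmpty_or_nonempty S with hS | ⟨⟨s₀⟩⟩
  · rw [orbitSpaceMeasure, Measure.eq_zero_of_isEmpty (σ.restrict X), Measure.map_zero]
    infer_instance
  let ρ : S → S := fun s => if s ∈ D.N then s₀ else (D.θ s)⁻¹ • s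
  have hρm : Measurable ρ := by
    refine Measurable.ite D.measurable_N measurable_const fun B hB => ?_
    have : (fun s => (D.θ s)⁻¹ • s) ⁻¹' B =
        ⋃ δ : Δ, D.θ ⁻¹' {δ} ∩ (fun s => δ⁻¹ • s) ⁻¹' B := by
      ext s; simp
    rw [this]
    exact MeasurableSet.iUnion fun δ => (D.measurable_θ δ).inter (measurable_const_smul _ hB)
  have hρinv : ∀ a b : S, (MulAction.orbitRel Δ S) a b → ρ a = ρ b := by
    rintro _ b ⟨δ, rfl⟩
    by_cases hb : b ∈ D.N
    · have : δ • b ∈ D.N := by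
        by_contra h
        have := D.right_notMem δ⁻¹ _ h
        rw [inv_smul_smul] at this
        exact this hb
      simp [ρ, hb, this]
    · have := D.right_notMem δ _ hb
      simp [ρ, hb, this, D.θ_smul δ b hb, smul_smul]
  let ρ' : MulAction.orbitRel.Quotient Δ S → S := Quotient.lift ρ hρinv
  have hρ'm : Measurable ρ' := measurable_from_quotient.2 hρm
  refine SigmaFinite.of_map _ hρ'm.aemeasurable ?_
  have e : (orbitSpaceMeasure Δ σ X).map ρ' = σ.restrict X := by
    rw [orbitSpaceMeasure, Measure.map_map hρ'm measurable_orbitMk,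
      Measure.restrict_congr_set hXD]
    conv_rhs => rw [← Measure.map_id (μ := σ.restrict D.domain)]
    refine Measure.map_congr ?_
    rw [EventuallyEq, ae_restrict_iff' D.measurableSet_domain]
    filter_upwards [D.ae_notMem] with s hs hs1
    have hs1' : D.θ s = 1 := hs1
    change ρ s = s
    simp [ρ, hs, hs1']
  rw [e]
  infer_instance

/-- An amenable pair has almost invariant weights. -/
theorem hasAlmostInvariantWeights [Countable Δ] [SigmaFinite σ] [MeasurableConstSMul Γ S]
    [MeasurableConstSMul Δ S] [SMulInvariantMeasure Γ S σ] [SMulInvariantMeasure Δ S σ]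
    (D : EquivariantSections Γ Δ σ) {X : Set S} (hX : IsFundamentalDomain Δ X σ)
    (hXD : X =ᵐ[σ] D.domain)
    (hG : IsAmenablePair Γ (MulAction.orbitRel.Quotient Δ S) (orbitSpaceMeasure Δ σ X)) :
    D.HasAlmostInvariantWeights := by
  classical
  intro K ε hε
  have := D.sigmaFinite_orbitSpaceMeasure hXD
  have := measurableConstSMul_orbitSpace (Γ := Γ) (Δ := Δ) (S := S)
  have := smulInvariantMeasure_orbitSpaceMeasure (Γ := Γ) hX
  obtain ⟨f, hfm, hf0, hfi, hf1, hf⟩ := hG.exists_almost_invariant_density K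
    (mul_pos two_pos hε)
  let π : S → MulAction.orbitRel.Quotient Δ S := Quotient.mk _
  have hπ : Measurable π := measurable_orbitMk
  have hμ : orbitSpaceMeasure Δ σ X = (σ.restrict D.domain).map π := by
    rw [orbitSpaceMeasure, Measure.restrict_congr_set hXD]
  rw [hμ] at hfi hf1
  have hfi' : IntegrableOn (fun s => f (π s)) D.domain σ :=
    (integrable_map_measure hfm.aestronglyMeasurable hπ.aemeasurable).1 hfi
  rw [integral_map hπ.aemeasurable hfm.aestronglyMeasurable] at hf1
  -- The square root turns an almost invariant `L¹` density into an `L²` weight.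
  let F : S → ℝ := fun s => if s ∈ D.N then 0 else √(f (π s))
  have hFsq : ∀ s, s ∉ D.N → F s ^ 2 = f (π s) := fun s hs => by
    simp only [F, hs, if_false]
    exact Real.sq_sqrt (hf0 _)
  have hFae : ∀ᵐ s ∂(σ.restrict D.domain), f (π s) = F s ^ 2 :=
    ae_restrict_of_ae (D.ae_notMem.mono fun s hs => (hFsq s hs).symm)
  have hFint : ∫ s in D.domain, F s ^ 2 ∂σ = 1 := by rw [← hf1, integral_congr_ae hFae]
  let W : D.Weight :=
    { F := F
      measurable := Measurable.ite D.measurable_N measurable_const (hfm.comp hπ).sqrt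
      nonneg := fun s => by
        by_cases hs : s ∈ D.N <;> simp [F, hs]
      right_smul := fun δ s => by
        have h1 : π (δ • s) = π s := Quotient.sound ⟨δ, rfl⟩
        have h2 : δ • s ∈ D.N ↔ s ∈ D.N := by
          refine ⟨fun h => by_contra fun h' => D.right_notMem δ s h' h, fun h => ?_⟩
          by_contra h'
          have := D.right_notMem δ⁻¹ _ h'
          rw [inv_smul_smul] at this
          exact this h
        simp only [F, h1, h2]
      eq_zero := fun s hs => by simp [F, hs]
      integrableOn_sq := hfi'.congr hFae
      integral_sq_le := hFint.le }
  refine ⟨W, hFint, fun γ hγ => ?_⟩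
  have hγf := hf γ hγ
  have hgm : Measurable fun q : MulAction.orbitRel.Quotient Δ S => |f (γ⁻¹ • q) - f q| :=
    ((hfm.comp (measurable_const_smul γ⁻¹)).sub hfm).abs
  rw [hμ, integral_map hπ.aemeasurable hgm.aestronglyMeasurable] at hγf
  have e : ∫ s in D.domain, |f (γ⁻¹ • π s) - f (π s)| ∂σ =
      ∫ s in D.domain, |W.F (γ⁻¹ • s) ^ 2 - W.F s ^ 2| ∂σ := by
    refine integral_congr_ae (ae_restrict_of_ae (D.ae_notMem.mono fun s hs => ?_))
    simp only [W]
    rw [hFsq _ hs, hFsq _ (D.left_notMem γ⁻¹ s hs)]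
    rfl
  rw [e] at hγf
  have i1 := W.integrableOn_smul_sq γ⁻¹
  have i2 := W.integrableOn_sq
  have i3 : IntegrableOn (fun s => |W.F (γ⁻¹ • s) ^ 2 - W.F s ^ 2|) D.domain σ := (i1.sub i2).abs
  have i12 : IntegrableOn (fun s => W.F (γ⁻¹ • s) ^ 2 + W.F s ^ 2) D.domain σ := i1.add i2
  have i4 := W.integrableOn_mul W γ⁻¹ 1
  simp only [one_smul] at i4
  -- For `a, b ≥ 0`, `ab ≥ min(a², b²) = (a² + b² - |a² - b²|)/2`. The integral is at least `1`
  -- minus half the `L¹` displacement, hence the tolerance `2 * ε` above.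
  have hle : ∫ s in D.domain, (W.F (γ⁻¹ • s) ^ 2 + W.F s ^ 2 -
      |W.F (γ⁻¹ • s) ^ 2 - W.F s ^ 2|) / 2 ∂σ ≤ ∫ s in D.domain, W.F (γ⁻¹ • s) * W.F s ∂σ := by
    refine integral_mono ((i12.sub i3).div_const 2) i4 fun s => ?_
    have ha := W.nonneg (γ⁻¹ • s)
    have hb := W.nonneg s
    simp only
    rcases le_total (W.F s) (W.F (γ⁻¹ • s)) with h | h
    · rw [abs_of_nonneg (by nlinarith)]; nlinarith
    · rw [abs_of_nonpos (by nlinarith)]; nlinarith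
  rw [integral_div, integral_sub i12 i3, integral_add i1 i2, W.integral_smul_sq] at hle
  have hWint : ∫ s in D.domain, W.F s ^ 2 ∂σ = 1 := hFint
  rw [hWint] at hle
  linarith

end EquivariantSections

end OrbitSpace

/-! ### Couplings -/

namespace IsMeasureCoupling

variable {Γ Δ S : Type*} [Group Γ] [Group Δ] [MeasurableSpace S] [MulAction Γ S] [MulAction Δ S]
  [SMulCommClass Γ Δ S] {σ : Measure S} {X Y : Set S}

theorem measurableConstSMul_left (h : IsMeasureCoupling Γ Δ σ X Y) : MeasurableConstSMul Γ S :=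
  ⟨fun γ => (h.measurePreserving_left γ).measurable⟩

theorem measurableConstSMul_right (h : IsMeasureCoupling Γ Δ σ X Y) : MeasurableConstSMul Δ S :=
  ⟨fun δ => (h.measurePreserving_right δ).measurable⟩

theorem smulInvariantMeasure_left (h : IsMeasureCoupling Γ Δ σ X Y) : SMulInvariantMeasure Γ S σ :=
  ⟨fun γ _ hs => (h.measurePreserving_left γ).measure_preimage hs.nullMeasurableSet⟩

theorem smulInvariantMeasure_right (h : IsMeasureCoupling Γ Δ σ X Y) :
    SMulInvariantMeasure Δ S σ :=
  ⟨fun δ _ hs => (h.measurePreserving_right δ).measure_preimage hs.nullMeasurableSet⟩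

theorem symm [SMulCommClass Δ Γ S] (h : IsMeasureCoupling Γ Δ σ X Y) :
    IsMeasureCoupling Δ Γ σ Y X where
  standard := h.standard
  sigmaFinite := h.sigmaFinite
  measurePreserving_left := h.measurePreserving_right
  measurePreserving_right := h.measurePreserving_left
  free_left := h.free_right
  free_right := h.free_left
  fundamentalDomain_right := h.fundamentalDomain_left
  fundamentalDomain_left := h.fundamentalDomain_right

/-- The weak forms of amenability pass from `Δ` to `Γ` if `(Γ, S/Δ)` is an amenable pair. -/
theorem permanence [Countable Γ] [Countable Δ] (h : IsMeasureCoupling Γ Δ σ X Y)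
    (hG : IsAmenablePair Γ (MulAction.orbitRel.Quotient Δ S) (orbitSpaceMeasure Δ σ X)) :
    (HasHaagerupProperty Δ → HasHaagerupProperty Γ) ∧
      cowlingHaagerupConst Γ ≤ cowlingHaagerupConst Δ ∧
      weakHaagerupConst Γ ≤ weakHaagerupConst Δ := by
  have := h.measurableConstSMul_left
  have := h.measurableConstSMul_right
  have := h.smulInvariantMeasure_left
  have := h.smulInvariantMeasure_right
  have := h.sigmaFinite
  obtain ⟨D, hXD⟩ := exists_equivariantSections h.fundamentalDomain_right h.fundamentalDomain_left
  have hD := D.hasAlmostInvariantWeights h.fundamentalDomain_right hXD hG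
  exact ⟨hD.hasHaagerupProperty, hD.cowlingHaagerupConst_le, hD.weakHaagerupConst_le⟩

end IsMeasureCoupling

/-- An invariant measure and an invariant set of finite positive measure give an amenable pair. -/
theorem isAmenablePair_of_invariant_set {G Q : Type*} [Group G] [MulAction G Q]
    [MeasurableSpace Q] {μ : Measure Q} [MeasurableConstSMul G Q] [SMulInvariantMeasure G Q μ]
    {A : Set Q} (hA : ∀ g : G, (fun x => g • x) ⁻¹' A = A) (hA0 : μ A ≠ 0) (hA1 : μ A < ∞) :
    IsAmenablePair G Q μ := by
  refine ⟨fun g => (measurePreserving_smul g μ).quasiMeasurePreserving, ?_⟩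
  have : IsFiniteMeasure (μ.restrict A) := ⟨by simpa using hA1⟩
  have hi : ∀ f : Lp ℂ ∞ μ, Integrable f (μ.restrict A) := fun f =>
    ((Lp.memLp f).restrict A).integrable le_top
  have hpos : 0 < μ.real A := ENNReal.toReal_pos hA0 hA1.ne
  refine ⟨{ toFun := fun f => ((μ.real A)⁻¹ : ℂ) * ∫ x in A, f x ∂μ
            map_add' := fun f g => ?_
            map_smul' := fun c f => ?_ }, fun f hf => ?_, fun f hf => ?_, fun g f f' hff' => ?_⟩
  · rw [← mul_add, ← integral_add (hi f) (hi g)]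
    congr 1
    exact integral_congr_ae (ae_restrict_of_ae (Lp.coeFn_add f g))
  · have h : ∫ x in A, (c • f) x ∂μ = c * ∫ x in A, f x ∂μ := by
      rw [← integral_const_mul]
      exact integral_congr_ae (ae_restrict_of_ae (Lp.coeFn_smul c f))
    rw [RingHom.id_apply, smul_eq_mul, h, mul_left_comm]
  · refine mul_nonneg ?_ (integral_nonneg_of_ae (ae_restrict_of_ae hf))
    rw [← Complex.ofReal_inv]
    exact_mod_cast (inv_pos.2 hpos).le
  · change ((μ.real A)⁻¹ : ℂ) * ∫ x in A, f x ∂μ = 1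
    rw [integral_congr_ae (ae_restrict_of_ae hf), setIntegral_const]
    simp only [Complex.real_smul, mul_one]
    exact inv_mul_cancel₀ (by exact_mod_cast hpos.ne')
  · change ((μ.real A)⁻¹ : ℂ) * ∫ x in A, f' x ∂μ = ((μ.real A)⁻¹ : ℂ) * ∫ x in A, f x ∂μ
    congr 1
    rw [integral_congr_ae (ae_restrict_of_ae hff')]
    have := (measurePreserving_smul g μ).setIntegral_preimage_emb (measurableEmbedding_const_smul g)
      f A
    rwa [hA g] at this

/-- The action on the first factor of a product. -/
@[reducible]
def fstMulAction (G S ι : Type*) [Group G] [MulAction G S] : MulAction G (S × ι) where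
  smul g p := (g • p.1, p.2)
  one_smul p := Prod.ext (one_smul G p.1) rfl
  mul_smul g h p := Prod.ext (mul_smul g h p.1) rfl

/-! ### From measure equivalence to amenable measure equivalence -/

section Amplification

attribute [local instance] fstMulAction

theorem smulCommClass_fst (Γ Δ S ι : Type*) [Group Γ] [Group Δ] [MulAction Γ S]
    [MulAction Δ S] [SMulCommClass Γ Δ S] : SMulCommClass Γ Δ (S × ι) :=
  ⟨fun γ δ p => Prod.ext (smul_comm γ δ p.1) rfl⟩

attribute [local instance] smulCommClass_fst

variable {Γ Δ S : Type*} [Group Γ] [Group Δ] [MeasurableSpace S] [MulAction Γ S] [MulAction Δ S]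
  [SMulCommClass Γ Δ S] {σ : Measure S} {X Y : Set S}

theorem IsMeasureCoupling.prod_count (h : IsMeasureCoupling Γ Δ σ X Y) :
    IsMeasureCoupling Γ Δ (σ.prod (Measure.count : Measure ℕ)) (Prod.fst ⁻¹' X)
      (Prod.fst ⁻¹' Y) := by
  have := h.sigmaFinite
  have := h.standard
  have hq : Measure.QuasiMeasurePreserving (Prod.fst : S × ℕ → S) (σ.prod Measure.count) σ :=
    Measure.quasiMeasurePreserving_fst
  exact
    { standard := inferInstance
      sigmaFinite := inferInstance
      measurePreserving_left := fun γ =>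
        (h.measurePreserving_left γ).prod (MeasurePreserving.id Measure.count)
      measurePreserving_right := fun δ =>
        (h.measurePreserving_right δ).prod (MeasurePreserving.id Measure.count)
      free_left := fun γ hγ => (hq.ae (h.free_left γ hγ)).mono fun p hp h' =>
        hp (congrArg Prod.fst h')
      free_right := fun δ hδ => (hq.ae (h.free_right δ hδ)).mono fun p hp h' =>
        hp (congrArg Prod.fst h')
      fundamentalDomain_right := h.fundamentalDomain_right.preimage_of_equiv hq (e := id)
        Function.bijective_id (fun _ _ => rfl)
      fundamentalDomain_left := h.fundamentalDomain_left.preimage_of_equiv hq (e := id)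
        Function.bijective_id (fun _ _ => rfl) }

/-- The `ℕ`-coordinate is constant on orbits and fixed by `Γ`. Its slice at `0` is an invariant set
of measure `σ X`, finite and nonzero, over which one can average. -/
theorem IsMeasureCoupling.isAmenablePair_prod_count [Countable Δ]
    (h : IsMeasureCoupling Γ Δ σ X Y) (hσ : σ ≠ 0) (hX : σ X < ∞) :
    IsAmenablePair Γ (MulAction.orbitRel.Quotient Δ (S × ℕ))
      (orbitSpaceMeasure Δ (σ.prod Measure.count) (Prod.fst ⁻¹' X)) := by
  have h' := h.prod_count
  have := h.sigmaFinite
  have := h'.measurableConstSMul_left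
  have := h'.measurableConstSMul_right
  have := h'.smulInvariantMeasure_left
  have := h'.smulInvariantMeasure_right
  have := measurableConstSMul_orbitSpace (Γ := Γ) (Δ := Δ) (S := S × ℕ)
  have := smulInvariantMeasure_orbitSpaceMeasure (Γ := Γ) h'.fundamentalDomain_right
  have hX0 : σ X ≠ 0 := by
    have := h.measurableConstSMul_right
    have := h.smulInvariantMeasure_right
    exact h.fundamentalDomain_right.measure_ne_zero hσ
  let p : MulAction.orbitRel.Quotient Δ (S × ℕ) → ℕ := Quotient.lift Prod.snd (by
    rintro _ b ⟨δ, rfl⟩; rfl)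
  have hp : Measurable p := measurable_from_quotient.2 measurable_snd
  have hμ : orbitSpaceMeasure Δ (σ.prod Measure.count) (Prod.fst ⁻¹' X) (p ⁻¹' {0}) = σ X := by
    rw [orbitSpaceMeasure, Measure.map_apply measurable_orbitMk
      (hp (measurableSet_singleton 0)), Measure.restrict_apply (measurable_orbitMk (hp (measurableSet_singleton 0)))]
    have : (Quotient.mk (MulAction.orbitRel Δ (S × ℕ)) ⁻¹' (p ⁻¹' {0})) ∩ Prod.fst ⁻¹' X =
        X ×ˢ {0} := by
      ext ⟨s, n⟩
      simp only [Set.mem_inter_iff, Set.mem_preimage, Set.mem_singleton_iff, Set.mem_prod]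
      exact and_comm
    rw [this, Measure.prod_prod, Measure.count_singleton, mul_one]
  refine isAmenablePair_of_invariant_set (A := p ⁻¹' {0}) (fun γ => ?_) (by rwa [hμ])
    (by rwa [hμ])
  ext q
  induction q using Quotient.inductionOn with
  | h x => exact Iff.rfl

theorem IsMeasureEquivalent.isAmenablyMeasureEquivalent {Γ : Type u} {Δ : Type v} [Group Γ]
    [Group Δ] [Countable Γ] [Countable Δ] (h : IsMeasureEquivalent.{u, v, w} Γ Δ) :
    IsAmenablyMeasureEquivalent.{u, v, w} Γ Δ := by
  obtain ⟨S, _, _, _, _, σ, X, Y, h, hσ, hX, hY⟩ := h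
  have := SMulCommClass.symm Γ Δ S
  have := h.sigmaFinite
  refine ⟨S × ℕ, inferInstance, inferInstance, inferInstance, inferInstance, inferInstance,
    σ.prod Measure.count, _, _, h.prod_count, ?_, h.isAmenablePair_prod_count hσ hX,
    h.symm.isAmenablePair_prod_count hσ hY⟩
  rw [← Set.univ_prod_univ, Measure.prod_prod, Measure.count_apply_infinite Set.infinite_univ]
  exact ENNReal.mul_top (Measure.measure_univ_ne_zero.2 hσ)

end Amplification

theorem theorem1p8 (Γ : Type u) (Δ : Type v) [Group Γ] [Group Δ]
    [Countable Γ] [Countable Δ] :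
    (IsAmenablyMeasureEquivalent.{u, v, w} Γ Δ →
      (HasHaagerupProperty Γ ↔ HasHaagerupProperty Δ) ∧
      cowlingHaagerupConst Γ = cowlingHaagerupConst Δ ∧
      weakHaagerupConst Γ = weakHaagerupConst Δ) ∧
    (IsMeasureEquivalent.{u, v, w} Γ Δ → IsAmenablyMeasureEquivalent.{u, v, w} Γ Δ) := by
  refine ⟨?_, fun h => h.isAmenablyMeasureEquivalent⟩
  rintro ⟨S, _, _, _, _, _, σ, X, Y, h, -, hΓ, hΔ⟩
  obtain ⟨a1, a2, a3⟩ := h.permanence hΓ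
  obtain ⟨b1, b2, b3⟩ := h.symm.permanence hΔ
  exact ⟨⟨b1, a1⟩, le_antisymm a2 b2, le_antisymm a3 b3⟩
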